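/- Vertex-Disjoint Paths is solvable in polynomial time on threshold graphs. Precisely: there is a (multi-stack) Turing machine that, given the adjacency matrix of a finite simple undirected graph $G$ that is a threshold graph, followed by an ordered multiset $\mathcal{X}=\{(s_1,t_1),\dots,(s_k,t_k)\}$ of pairs of distinct vertices of $G$ (pairs may be repeated and may share vertices), decides in time polynomial in the length of the input whether $G$ contains $k$ pairwise distinct and pairwise internally vertex-disjoint paths $P_1,\dots,P_k$ such that $P_i$ is an $(s_i,t_i)$-path for every $i\in\{1,\dots,k\}$. Here $G$ is a threshold graph if $V(G)$ has a partition $(C,I)$ into a clique $C$ and an independent set $I$ whose vertices can be ordered as $v_1,\dots,v_{|I|}$ with $N(v_1)\subseteq N(v_2)\subseteq\dots\subseteq N(v_{|I|})$. An $(s,t)$-path $P$ and an $(s',t')$-path $P'$ are internally vertex-disjoint if no vertex of $V(P)\setminus\{s,t\}$ lies on $P'$ and no vertex of $V(P')\setminus\{s',t'\}$ lies on $P$. Paths are identified with subgraphs, so that a path and its reversal are not distinct. -/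

import Mathlib

open Computability

namespace DisjointPaths

/-- `G` is a threshold graph: its vertex set has a partition into a clique `C` and an independent
set `I`, and the vertices of `I` can be listed as `v₁, v₂, …` (each exactly once) so that
`N(v₁) ⊆ N(v₂) ⊆ ⋯`. -/
def IsThreshold {V : Type*} (G : SimpleGraph V) : Prop :=
  ∃ C I : Set V, IsCompl C I ∧ G.IsClique C ∧ G.IsIndepSet I ∧
    ∃ l : List V, l.Nodup ∧ (∀ v, v ∈ l ↔ v ∈ I) ∧
      l.Pairwise fun u v => G.neighborSet u ⊆ G.neighborSet v

/-- No internal vertex of one of the two walks is visited by the other one. -/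
def InternallyDisjoint {V : Type*} {G : SimpleGraph V} {s t s' t' : V}
    (P : G.Walk s t) (Q : G.Walk s' t') : Prop :=
  (∀ v ∈ P.support, v ≠ s → v ≠ t → v ∉ Q.support) ∧
    (∀ v ∈ Q.support, v ≠ s' → v ≠ t' → v ∉ P.support)

/-- There are paths `P₁, …, P_k`, where `P_i` joins the two vertices of the `i`-th terminal pair,
which are pairwise distinct and pairwise internally vertex-disjoint. Paths are compared as
subgraphs, so that the direction in which a path is traversed is irrelevant. -/
def HasDisjointPaths {V : Type*} (G : SimpleGraph V) (X : List (V × V)) : Prop :=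
  ∃ P : ∀ i : Fin X.length, G.Walk (X.get i).1 (X.get i).2,
    (∀ i, (P i).IsPath) ∧
      ∀ i j, i ≠ j → (P i).toSubgraph ≠ (P j).toSubgraph ∧ InternallyDisjoint (P i) (P j)

/-- An instance of Vertex-Disjoint Paths: a finite simple graph, with vertices `0, …, n - 1`, and
an ordered multiset of pairs of distinct vertices. Pairs may repeat and may share vertices. -/
structure VDPInstance where
  n : ℕ
  graph : SimpleGraph (Fin n)
  pairs : List (Fin n × Fin n)
  pairs_ne : ∀ p ∈ pairs, p.1 ≠ p.2

/-- The words `w₁, w₂, …`, each followed by a comma. -/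
def delimit (L : List (List Γ')) : List Γ' :=
  L.flatMap fun w => w ++ [Γ'.comma]

/-- The number `m` as a word of `m` ones. -/
def unary (m : ℕ) : List Γ' :=
  List.replicate m (Γ'.bit true)

open Classical in
/-- The row of the adjacency matrix that belongs to the vertex `u`. -/
noncomputable def adjRow {n : ℕ} (G : SimpleGraph (Fin n)) (u : Fin n) : List Γ' :=
  List.ofFn fun v => Γ'.bit (decide (G.Adj u v))

/-- The input word of an instance: the rows of the adjacency matrix, then the symbol `bra`, then the
terminal pairs in the given order, each by its two endpoints. Vertices are written in unary; as they
are smaller than the number of rows, this is polynomially equivalent to writing them in binary. -/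
noncomputable def VDPInstance.encode (x : VDPInstance) : List Γ' :=
  delimit (List.ofFn (adjRow x.graph)) ++
    Γ'.bra :: delimit (x.pairs.flatMap fun p => [unary p.1, unary p.2])

open Classical in
/-- The decision problem `Q`, restricted to the inputs in the class `C`, is solvable in polynomial
time: some multi-stack Turing machine that is started on the input word of any `a` with `C a` halts
with the correct answer to "does `Q a` hold?" within a number of steps that is bounded by a fixed
polynomial in the length of the input word. -/
def SolvableInPolyTimeOn {α Γ : Type} (encode : α → List Γ) (C Q : α → Prop) : Prop :=
  Nonempty (Turing.TM2ComputableInPolyTime (fun a : {a : α // C a} => encode a) encodeBool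
    fun a => decide (Q a))

theorem delimit_injective {L M : List (List Γ')} (hL : ∀ w ∈ L, Γ'.comma ∉ w)
    (hM : ∀ w ∈ M, Γ'.comma ∉ w) (h : delimit L = delimit M) : L = M := by
  induction L generalizing M with
  | nil => cases M with
    | nil => rfl
    | cons w M => simp [delimit] at h
  | cons v L ih => cases M with
    | nil => simp [delimit] at h
    | cons w M =>
      have h' : v ++ Γ'.comma :: delimit L = w ++ Γ'.comma :: delimit M := by
        simpa [delimit] using h
      have hv := hL v (by simp)
      have hw := hM w (by simp)
      have key : ∀ (v w a b : List Γ'), Γ'.comma ∉ v → Γ'.comma ∉ w →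
          v ++ Γ'.comma :: a = w ++ Γ'.comma :: b → v = w ∧ a = b := by
        intro v
        induction v with
        | nil => intro w a b _ hw h; cases w <;> simp_all
        | cons c v ihv =>
          intro w a b hv hw h
          cases w with
          | nil => simp_all
          | cons d w =>
            simp only [List.cons_append, List.cons.injEq] at h
            have := ihv w a b (by simp_all) (by simp_all) h.2
            simp_all
      obtain ⟨rfl, h2⟩ := key _ _ _ _ hv hw h'
      rw [ih (fun w hw => hL w (by simp [hw])) (fun w hw => hM w (by simp [hw])) h2]

/-- Different instances have different input words. -/
theorem VDPInstance.encode_injective : Function.Injective VDPInstance.encode := by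
  have hbra : ∀ L : List (List Γ'), (∀ w ∈ L, Γ'.bra ∉ w) → Γ'.bra ∉ delimit L := by
    intro L hL
    simp only [delimit, List.mem_flatMap, not_exists, not_and]
    intro w hw
    simp [hL w hw]
  rintro ⟨n, G, X, hX⟩ ⟨m, H, Y, hY⟩ h
  simp only [VDPInstance.encode] at h
  have hrow : ∀ {n : ℕ} (G : SimpleGraph (Fin n)) (c : Γ'), (∀ b, c ≠ Γ'.bit b) →
      ∀ w ∈ List.ofFn (adjRow G), c ∉ w := by
    intro n G c hc w hw
    obtain ⟨u, rfl⟩ := (List.mem_ofFn' _ _).1 hw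
    intro hcw
    obtain ⟨v, hv⟩ := (List.mem_ofFn' _ _).1 hcw
    exact hc _ hv.symm
  have hpair : ∀ {n : ℕ} (X : List (Fin n × Fin n)) (c : Γ'), (∀ b, c ≠ Γ'.bit b) →
      ∀ w ∈ X.flatMap (fun p => [unary p.1, unary p.2]), c ∉ w := by
    intro n X c hc w hw hcw
    simp only [List.mem_flatMap, List.mem_cons, List.not_mem_nil, or_false] at hw
    obtain ⟨p, _, rfl | rfl⟩ := hw <;> exact hc _ (List.eq_of_mem_replicate hcw)
  rw [List.append_eq_append_iff] at h
  have hG := hbra _ (hrow G Γ'.bra (by simp))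
  have hH := hbra _ (hrow H Γ'.bra (by simp))
  have hsplit : delimit (List.ofFn (adjRow G)) = delimit (List.ofFn (adjRow H)) ∧
      delimit (X.flatMap fun p => [unary p.1, unary p.2]) =
        delimit (Y.flatMap fun p => [unary p.1, unary p.2]) := by
    rcases h with ⟨a, h1, h2⟩ | ⟨a, h1, h2⟩
    · cases a with
      | nil => simp_all
      | cons c a => simp only [List.cons_append, List.cons.injEq] at h2; simp_all
    · cases a with
      | nil => simp_all
      | cons c a => simp only [List.cons_append, List.cons.injEq] at h2; simp_all
  have e1 := delimit_injective (hrow G _ (by simp)) (hrow H _ (by simp)) hsplit.1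
  have e2 := delimit_injective (hpair X _ (by simp)) (hpair Y _ (by simp)) hsplit.2
  have hnm : n = m := by simpa using congrArg List.length e1
  subst hnm
  have hGH : G = H := by
    ext u v
    have := congrFun (List.ofFn_injective (congrFun (List.ofFn_injective e1) u)) v
    simpa using this
  have hXY : X = Y := by
    have hu : ∀ a b : Fin n, unary a = unary b → a = b := fun a b hab =>
      Fin.ext (by simpa [unary] using congrArg List.length hab)
    clear hsplit h hX hY
    induction X generalizing Y with
    | nil => cases Y <;> simp_all
    | cons p X ih => cases Y with
      | nil => simp at e2
      | cons q Y =>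
        simp only [List.flatMap_cons, List.cons_append, List.nil_append, List.cons.injEq] at e2
        rw [ih Y e2.2.2, Prod.ext (hu _ _ e2.1) (hu _ _ e2.2.1)]
  subst hGH hXY
  rfl

end DisjointPaths

/-! In a threshold graph the neighbourhoods of any two vertices are comparable, up to the two
vertices themselves (`IsThreshold.adj_imp_or_adj_imp`). If N(s) without t lies in N(t), then the
second vertex of any (s,t)-path other than the edge is a common neighbour of s and t. By symmetry,
every path that is not an edge can be shortened to one with a single inner vertex
(`IsThreshold.exists_common_neighbor`). The edge st serves only one occurrence of its unordered
pair, and an exchange makes this the first one. A solution thus amounts to distinct inner vertices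
for the remaining pairs (`NeedsInner`), each a common neighbour of its pair and not a terminal
(`CanServe`).

These candidate sets form a chain under inclusion (`IsThreshold.canServe_imp_or_imp`), so Hall's
condition reduces to a count: for each c, at most c of the pairs in need have at most c candidates
(`IsThreshold.hasDisjointPaths_iff`). This criterion is a fixed formula of first-order logic with
counting, `CountFormula.disjointPaths`.

Such a formula is decided by nested loops over unary counters; a quantifier multiplies the running
time by roughly the input length, and the nesting depth is fixed (`CountFormula.exec_toProg`). To
reach actual Turing machines, a small structured language `StackProg` is given a timed semantics
`Exec` and compiled to machine code with the same time bound (`StackProg.Exec.reachesIn`). -/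

namespace DisjointPaths

/-! ### Structured stack programs and their compilation to Turing machines -/

open Turing Function

/-- Structured programs that act on finitely many stacks over the alphabet `Γ`, indexed by `K`, and
on an internal state in `σ`. -/
inductive StackProg (K Γ σ : Type)
  | push (k : K) (f : σ → Γ)
  | pop (k : K) (f : σ → Option Γ → σ)
  | load (f : σ → σ)
  | seq (a b : StackProg K Γ σ)
  | ite (p : σ → Bool) (a b : StackProg K Γ σ)
  | loop (p : σ → Bool) (a : StackProg K Γ σ)

namespace StackProg

variable {K Γ σ : Type}

/-- The labels of the machine code of a program. -/
def Label : StackProg K Γ σ → Type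
  | push _ _ => Unit
  | pop _ _ => Unit
  | load _ => Unit
  | seq a b => a.Label ⊕ b.Label
  | ite _ a b => Option (a.Label ⊕ b.Label)
  | loop _ a => Option a.Label

/-- The label at which the execution of a program starts. -/
def entry : (c : StackProg K Γ σ) → c.Label
  | push _ _ => ()
  | pop _ _ => ()
  | load _ => ()
  | seq a _ => Sum.inl a.entry
  | ite _ _ _ => none
  | loop _ _ => none

noncomputable instance labelFintype : (c : StackProg K Γ σ) → Fintype c.Label
  | push _ _ => inferInstanceAs (Fintype Unit)
  | pop _ _ => inferInstanceAs (Fintype Unit)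
  | load _ => inferInstanceAs (Fintype Unit)
  | seq a b =>
    have := labelFintype a
    have := labelFintype b
    inferInstanceAs (Fintype (a.Label ⊕ b.Label))
  | ite _ a b =>
    have := labelFintype a
    have := labelFintype b
    inferInstanceAs (Fintype (Option (a.Label ⊕ b.Label)))
  | loop _ a =>
    have := labelFintype a
    inferInstanceAs (Fintype (Option a.Label))

/-- The alphabets of the machine of a program: `none` is an additional output stack. -/
def Alphabet (K Γ : Type) : Option K → Type
  | none => Bool
  | some _ => Γ

/-- The machine code of a program, with its labels embedded into `Λ`, that jumps to `exit` when the
program ends. -/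
def code {Λ : Type} : (c : StackProg K Γ σ) → (c.Label → Λ) → Λ → c.Label →
    TM2.Stmt (Alphabet K Γ) Λ σ
  | push k f, _, exit, _ => .push (some k) f (.goto fun _ => exit)
  | pop k f, _, exit, _ => .pop (some k) f (.goto fun _ => exit)
  | load f, _, exit, _ => .load f (.goto fun _ => exit)
  | seq a b, emb, _, Sum.inl l => a.code (fun l => emb (Sum.inl l)) (emb (Sum.inr b.entry)) l
  | seq _ b, emb, exit, Sum.inr l => b.code (fun l => emb (Sum.inr l)) exit l
  | ite p a b, emb, _, none => .branch p (.goto fun _ => emb (some (Sum.inl a.entry)))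
      (.goto fun _ => emb (some (Sum.inr b.entry)))
  | ite _ a _, emb, exit, some (Sum.inl l) => a.code (fun l => emb (some (Sum.inl l))) exit l
  | ite _ _ b, emb, exit, some (Sum.inr l) => b.code (fun l => emb (some (Sum.inr l))) exit l
  | loop p a, emb, exit, none => .branch p (.goto fun _ => emb (some a.entry))
      (.goto fun _ => exit)
  | loop _ a, emb, _, some l => a.code (fun l => emb (some l)) (emb none) l

/-- The stacks of the machine of a program, with an empty output stack. -/
def liftStacks (S : K → List Γ) : (k : Option K) → List (Alphabet K Γ k)
  | none => []
  | some k => S k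

variable [DecidableEq K]

theorem update_liftStacks (S : K → List Γ) (k : K) (l : List Γ) :
    update (liftStacks S) (some k) (show List (Alphabet K Γ (some k)) from l) =
      liftStacks (update S k l) := by
  funext k'
  rcases k' with _ | k'
  · exact update_of_ne (by simp) _ _
  · by_cases h : k' = k
    · subst h
      exact (update_self ..).trans (update_self (f := S) ..).symm
    · exact (update_of_ne (by simpa using h) _ _).trans (update_of_ne h _ _).symm

/-- `Exec c s s' t`: the program `c`, when started in `s`, ends in `s'` within `t` steps. -/
inductive Exec : StackProg K Γ σ → σ × (K → List Γ) → σ × (K → List Γ) → ℕ → Prop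
  | push (k f v S) : Exec (.push k f) (v, S) (v, update S k (f v :: S k)) 1
  | pop (k f v S) : Exec (.pop k f) (v, S) (f v (S k).head?, update S k (S k).tail) 1
  | load (f v S) : Exec (.load f) (v, S) (f v, S) 1
  | seq {a b s s' s'' t t'} (h : Exec a s s' t) (h' : Exec b s' s'' t') :
      Exec (.seq a b) s s'' (t + t')
  | ite_true {p a b v S s' t} (hp : p v = true) (h : Exec a (v, S) s' t) :
      Exec (.ite p a b) (v, S) s' (t + 1)
  | ite_false {p a b v S s' t} (hp : p v = false) (h : Exec b (v, S) s' t) :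
      Exec (.ite p a b) (v, S) s' (t + 1)
  | loop_false {p a v S} (hp : p v = false) : Exec (.loop p a) (v, S) (v, S) 1
  | loop_true {p a v S s' s'' t t'} (hp : p v = true) (h : Exec a (v, S) s' t)
      (h' : Exec (.loop p a) s' s'' t') : Exec (.loop p a) (v, S) s'' (t + 1 + t')
  | mono {c s s' t t'} (h : Exec c s s' t) (ht : t ≤ t') : Exec c s s' t'

/-- `b` is reached from `a` within `t` steps of the machine with the code `M`. -/
def ReachesIn {Λ : Type} (M : Λ → TM2.Stmt (Alphabet K Γ) Λ σ) (a b : TM2.Cfg (Alphabet K Γ) Λ σ)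
    (t : ℕ) : Prop :=
  ∃ n ≤ t, (flip bind (TM2.step M))^[n] (some a) = some b

theorem ReachesIn.trans {Λ : Type} {M : Λ → TM2.Stmt (Alphabet K Γ) Λ σ}
    {a b c : TM2.Cfg (Alphabet K Γ) Λ σ} {t t' : ℕ} (h : ReachesIn M a b t)
    (h' : ReachesIn M b c t') : ReachesIn M a c (t + t') := by
  obtain ⟨n, hn, h⟩ := h
  obtain ⟨n', hn', h'⟩ := h'
  exact ⟨n' + n, by omega, by rw [iterate_add_apply, h, h']⟩

theorem ReachesIn.single {Λ : Type} {M : Λ → TM2.Stmt (Alphabet K Γ) Λ σ}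
    {l : Λ} {v : σ} {S : (k : Option K) → List (Alphabet K Γ k)} {b : TM2.Cfg (Alphabet K Γ) Λ σ}
    (h : TM2.stepAux (M l) v S = b) : ReachesIn M ⟨some l, v, S⟩ b 1 :=
  ⟨1, le_rfl, by rw [← h]; rfl⟩

theorem ReachesIn.mono {Λ : Type} {M : Λ → TM2.Stmt (Alphabet K Γ) Λ σ}
    {a b : TM2.Cfg (Alphabet K Γ) Λ σ} {t t' : ℕ} (h : ReachesIn M a b t) (ht : t ≤ t') :
    ReachesIn M a b t' := by
  obtain ⟨n, hn, h⟩ := h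
  exact ⟨n, hn.trans ht, h⟩

/-- Induction on the run. The machine `M` only has to agree with the code on the embedded labels,
for arbitrary `emb` and `exit`, so that the induction hypotheses apply to subprograms sitting inside
a larger machine. A whole `TM2` statement up to its `goto` is one step, which gives cost 1 to each
primitive and each test. -/
theorem Exec.reachesIn {Λ : Type} {M : Λ → TM2.Stmt (Alphabet K Γ) Λ σ} {c : StackProg K Γ σ}
    {s s' : σ × (K → List Γ)} {t : ℕ} (h : Exec c s s' t) :
    ∀ (emb : c.Label → Λ) (exit : Λ), (∀ l, M (emb l) = c.code emb exit l) →
      ReachesIn M ⟨some (emb c.entry), s.1, liftStacks s.2⟩ ⟨some exit, s'.1, liftStacks s'.2⟩ t := by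
  induction h with
  | push k f v S =>
    intro emb exit hM
    apply ReachesIn.single
    rw [hM]
    simp only [code, TM2.stepAux, ← update_liftStacks]
    rfl
  | pop k f v S =>
    intro emb exit hM
    apply ReachesIn.single
    rw [hM]
    simp only [code, TM2.stepAux, ← update_liftStacks]
    rfl
  | load f v S =>
    intro emb exit hM
    apply ReachesIn.single
    rw [hM]
    simp only [code, TM2.stepAux]
  | seq h h' ih ih' =>
    intro emb exit hM
    exact (ih _ _ fun l => hM (Sum.inl l)).trans (ih' _ _ fun l => hM (Sum.inr l))
  | ite_true hp h ih =>
    intro emb exit hM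
    rw [add_comm]
    refine ReachesIn.trans (ReachesIn.single ?_) (ih _ _ fun l => hM (some (Sum.inl l)))
    rw [hM]
    simp [code, entry, TM2.stepAux, hp]
  | ite_false hp h ih =>
    intro emb exit hM
    rw [add_comm]
    refine ReachesIn.trans (ReachesIn.single ?_) (ih _ _ fun l => hM (some (Sum.inr l)))
    rw [hM]
    simp [code, entry, TM2.stepAux, hp]
  | loop_false hp =>
    intro emb exit hM
    apply ReachesIn.single
    rw [hM]
    simp [code, entry, TM2.stepAux, hp]
  | loop_true hp h h' ih ih' =>
    intro emb exit hM
    rw [add_comm _ 1]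
    refine ReachesIn.trans (ReachesIn.trans (ReachesIn.single ?_) (ih _ _ fun l => hM (some l)))
      (ih' _ _ hM)
    rw [hM]
    simp [code, entry, TM2.stepAux, hp]
  | mono h ht ih => exact fun emb exit hM => (ih emb exit hM).mono ht

/-- The machine that runs the program `c` and then outputs the bit `out v`, for the internal state
`v` that is reached. -/
noncomputable def machine [Fintype K] [Fintype Γ] [Fintype σ] (c : StackProg K Γ σ) (k₀ : K)
    (v₀ : σ) (out : σ → Bool) : FinTM2 where
  K := Option K
  k₀ := some k₀
  k₁ := none
  Γ := Alphabet K Γ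
  Λ := Option c.Label
  main := some c.entry
  σ := σ
  initialState := v₀
  Γk₀Fin := inferInstanceAs (Fintype Γ)
  m
    -- `haltList` demands the initial state in the final configuration, hence the reset to `v₀`.
    | none => .push none out (.load (fun _ => v₀) .halt)
    | some l => c.code some none l

/-- The program must empty all its stacks, because `haltList` allows nothing but the output; the
answer survives only in the internal state. -/
theorem nonempty_computableInPolyTime [Fintype K] [Fintype Γ] [Fintype σ] {α : Type}
    {enc : α → List Γ} {f : α → Bool} (c : StackProg K Γ σ) (k₀ : K) (v₀ : σ) (out : σ → Bool)
    (p : Polynomial ℕ)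
    (h : ∀ a, ∃ v, out v = f a ∧
      Exec c (v₀, update (fun _ => []) k₀ (enc a)) (v, fun _ => []) (p.eval (enc a).length)) :
    Nonempty (TM2ComputableInPolyTime enc encodeBool f) := by
  refine ⟨{
    tm := machine c k₀ v₀ out
    inputAlphabet := Equiv.refl Γ
    outputAlphabet := Equiv.refl Bool
    -- The extra step outputs the bit.
    time := p + 1
    outputsFun := fun a => ?_ }⟩
  choose v hv hc using h
  have key : ReachesIn (machine c k₀ v₀ out).m
      (initList (machine c k₀ v₀ out) ((enc a).map (Equiv.refl Γ).invFun))
      (haltList (machine c k₀ v₀ out) ((encodeBool (f a)).map (Equiv.refl Bool).invFun))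
      (p.eval (enc a).length + 1) := by
    have h1 := (hc a).reachesIn (M := (machine c k₀ v₀ out).m) some none (fun l => rfl)
    have h2 : ReachesIn (machine c k₀ v₀ out).m ⟨some none, v a, liftStacks fun _ => []⟩
        (haltList (machine c k₀ v₀ out) ((encodeBool (f a)).map (Equiv.refl Bool).invFun)) 1 := by
      apply ReachesIn.single
      simp only [machine, TM2.stepAux, haltList, hv]
      congr 1
      funext k
      rcases k with _ | k
      · simp [liftStacks, encodeBool]; rfl
      · simp [liftStacks]; rfl
    have e : initList (machine c k₀ v₀ out) ((enc a).map (Equiv.refl Γ).invFun) =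
        ⟨some (some c.entry), v₀, liftStacks (update (fun _ => []) k₀ (enc a))⟩ := by
      simp only [machine, initList]
      congr 1
      funext k
      rcases k with _ | k
      · simp [liftStacks]
      · by_cases hk : k = k₀
        · subst hk; simp [liftStacks]; exact List.map_id _
        · simp [liftStacks, hk]; rfl
    rw [e]
    exact h1.trans h2
  have : ∃ n ≤ p.eval (enc a).length + 1, _ := key
  refine ⟨⟨this.choose, this.choose_spec.2⟩, ?_⟩
  rw [Polynomial.eval_add, Polynomial.eval_one]
  exact this.choose_spec.1

end StackProg

end DisjointPaths

/-! ### Basic programs on unary counters and tapes -/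

namespace DisjointPaths

open Turing Function

namespace StackProg

variable {K Γ σ : Type} [DecidableEq K]

theorem Exec.congr {c : StackProg K Γ σ} {s s' s'' : σ × (K → List Γ)} {t t' : ℕ}
    (h : Exec c s s' t) (hs : s' = s'') (ht : t ≤ t') : Exec c s s'' t' :=
  hs ▸ h.mono ht

/-- The loop rule: `I m` is the configuration after `m` rounds. Each round pays 1 for its test, and
the last, failing test adds 1. -/
theorem Exec.iterate {p : σ → Bool} {a : StackProg K Γ σ} (I : ℕ → σ × (K → List Γ)) {t : ℕ}
    (n : ℕ) (hn : p (I n).1 = false) (h : ∀ m < n, p (I m).1 = true ∧ Exec a (I m) (I (m + 1)) t) :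
    Exec (.loop p a) (I 0) (I n) (n * (t + 1) + 1) := by
  -- Induction on the number `j` of rounds that are left, since `Exec` unfolds a loop from its first
  -- round.
  suffices H : ∀ j ≤ n, Exec (.loop p a) (I (n - j)) (I n) (j * (t + 1) + 1) by
    simpa using H n le_rfl
  intro j
  induction j with
  | zero => exact fun _ => (Exec.loop_false hn).congr rfl (by simp)
  | succ j ih =>
    intro hj
    obtain ⟨hp, hb⟩ := h (n - (j + 1)) (by omega)
    rw [show n - (j + 1) + 1 = n - j by omega] at hb
    exact (Exec.loop_true hp hb (ih (by omega))).congr rfl (by linarith)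

end StackProg

open StackProg

/-- The stacks of a program that works on tapes in `T` and with counters in `V`. Each tape consists
of two stacks; each counter has a position and a remainder, by which the position falls short of its
bound, and an accumulator. -/
inductive Stk (T V : Type)
  | inp
  | tmp
  | left (t : T)
  | right (t : T)
  | pos (x : V)
  | rem (x : V)
  | acc (x : V)
  deriving DecidableEq, Fintype

/-- The internal state of a program: a flag and a register for a symbol. -/
abbrev Reg : Type := Bool × Option Γ'

/-- Programs on the stacks `Stk T V`. -/
abbrev Prog (T V : Type) : Type := StackProg (Stk T V) Γ' Reg

/-- The contents of the stacks. -/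
abbrev Mem (T V : Type) : Type := Stk T V → List Γ'

namespace Prog

variable {T V : Type}

/-- Pop into the register. -/
def popReg (k : Stk T V) : Prog T V := .pop k fun v o => (v.1, o)

/-- Push the register. -/
def pushReg (k : Stk T V) : Prog T V := .push k fun v => v.2.getD .blank

/-- Push a unit of a unary counter. -/
def pushUnit (k : Stk T V) : Prog T V := .push k fun _ => .bit true

/-- Is the register filled? -/
def filled (v : Reg) : Bool := v.2.isSome

/-- Pop all symbols of the stack `a` and push them to the stack `b`. -/
def move (a b : Stk T V) : Prog T V :=
  .seq (popReg a) (.loop filled (.seq (pushReg b) (popReg a)))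

/-- Pop all symbols of a stack. -/
def clear (k : Stk T V) : Prog T V := .seq (popReg k) (.loop filled (popReg k))

/-- Set the flag if the first counter is at most the second one. -/
def compare (a b : Stk T V) : Prog T V :=
  .seq (.load fun v => (true, v.2)) <|
  .seq (.seq (popReg a) (.loop (fun v => v.1 && v.2.isSome)
    (.seq (popReg b) (.ite filled (.seq (pushUnit .tmp) (popReg a))
      (.seq (pushUnit a) (.load fun v => (false, v.2)))))))
  (.seq (popReg .tmp) (.loop filled (.seq (pushUnit a) (.seq (pushUnit b) (popReg .tmp)))))

/-- Repeat a program as often as the position of `x` says. -/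
def repeatPos (x : V) (body : Prog T V) : Prog T V :=
  .seq (.seq (popReg (.pos x))
    (.loop filled (.seq (.seq (pushUnit .tmp) body) (popReg (.pos x))))) (move .tmp (.pos x))

/-- Go to the next word of a tape. -/
def nextWord (t : T) : Prog T V :=
  .seq (popReg (.right t)) <|
  .seq (.loop (fun v => v.2 ≠ some .comma) (.seq (pushReg (.left t)) (popReg (.right t))))
    (pushReg (.left t))

/-- Go to the next symbol of the word; if it has ended, clear the flag. -/
def nextSymbol (t : T) : Prog T V :=
  .seq (popReg (.right t)) <|
  .ite (fun v => v.2 = some .comma) (.seq (pushReg (.right t)) (.load fun v => (false, v.2)))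
    (pushReg (.left t))

/-- Set the flag if the word number `x` of a tape, followed by a comma, has the symbol `c` at the
position `y`. -/
def lookup (t : T) (x y : V) (c : Γ') : Prog T V :=
  .seq (repeatPos x (nextWord t)) <|
  .seq (.load fun v => (true, v.2)) <|
  .seq (repeatPos y (nextSymbol t)) <|
  .seq (popReg (.right t)) <|
  .seq (pushReg (.right t)) <|
  .seq (.load fun v => (v.1 && v.2 = some c, v.2)) <|
  move (.left t) (.right t)

/-- Set the flag if the program `body` sets it for at most `y` values of `x`. -/
def countLe (x : V) (body : Prog T V) (y : V) : Prog T V :=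
  .seq (.seq (popReg (.rem x)) (.loop filled
    (.seq body (.seq (.ite Prod.fst (pushUnit (.acc x)) (.load id))
      (.seq (pushUnit (.pos x)) (popReg (.rem x)))))))
  (.seq (move (.pos x) (.rem x)) (.seq (compare (.acc x) (.pos y)) (clear (.acc x))))

variable [DecidableEq T] [DecidableEq V]

theorem exec_popReg {k : Stk T V} {f : Bool} {o : Option Γ'} {S : Mem T V} :
    Exec (popReg k) ((f, o), S) ((f, (S k).head?), update S k (S k).tail) 1 :=
  Exec.pop k _ _ S

theorem exec_pushReg {k : Stk T V} {f : Bool} {a : Γ'} {S : Mem T V} :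
    Exec (pushReg k) ((f, some a), S) ((f, some a), update S k (a :: S k)) 1 :=
  Exec.push k _ _ S

theorem exec_pushUnit {k : Stk T V} {v : Reg} {S : Mem T V} :
    Exec (pushUnit k) (v, S) (v, update S k (.bit true :: S k)) 1 :=
  Exec.push k _ _ S

/-- Loops read ahead: on entry the register holds the head of the remaining list `l` and the stack
only its tail. This convention recurs in the other loops that consume a stack. -/
theorem exec_move_loop {a b : Stk T V} (hab : a ≠ b) {f : Bool} (l : List Γ') {S : Mem T V}
    (hS : S a = l.tail) :
    Exec (.loop filled (.seq (pushReg b) (popReg a))) ((f, l.head?), S)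
      ((f, none), update (update S a []) b (l.reverse ++ S b)) (3 * l.length + 1) := by
  induction l generalizing S with
  | nil =>
    have h : update S a [] = S := update_eq_self_iff.2 (by simpa using hS.symm)
    exact (Exec.loop_false rfl).congr (by simp [h]) (by simp)
  | cons c l ih =>
    refine (Exec.loop_true rfl ((Exec.seq exec_pushReg exec_popReg).congr
      (s'' := ((f, l.head?), update (update S b (c :: S b)) a l.tail)) ?_ le_rfl)
      (ih (by simp))).congr ?_ ?_
    · simp_all
    · congr 1
      funext k
      simp only [update_apply]
      split_ifs <;> simp_all
    · simp; omega

theorem exec_move {a b : Stk T V} (hab : a ≠ b) {f : Bool} {o : Option Γ'} {S : Mem T V} :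
    Exec (move a b) ((f, o), S) ((f, none), update (update S a []) b ((S a).reverse ++ S b))
      (3 * (S a).length + 2) := by
  refine (Exec.seq exec_popReg (exec_move_loop hab (S a) (by simp))).congr ?_ (by omega)
  congr 1
  funext k
  simp only [update_apply]
  split_ifs <;> simp_all

theorem exec_clear_loop {a : Stk T V} {f : Bool} (l : List Γ') {S : Mem T V}
    (hS : S a = l.tail) :
    Exec (.loop filled (popReg a)) ((f, l.head?), S) ((f, none), update S a [])
      (2 * l.length + 1) := by
  induction l generalizing S with
  | nil =>
    have h : update S a [] = S := update_eq_self_iff.2 (by simpa using hS.symm)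
    exact (Exec.loop_false rfl).congr (by simp [h]) (by simp)
  | cons c l ih =>
    refine (Exec.loop_true rfl (exec_popReg.congr (s'' := ((f, l.head?), update S a l.tail)) ?_
      le_rfl) (ih (by simp))).congr ?_ (by simp; omega)
    · simp_all
    · simp

theorem exec_clear {a : Stk T V} {f : Bool} {o : Option Γ'} {S : Mem T V} :
    Exec (clear a) ((f, o), S) ((f, none), update S a []) (2 * (S a).length + 2) :=
  (Exec.seq exec_popReg (exec_clear_loop (S a) (by simp))).congr (by simp) (by omega)

/-- The unary representation of a counter that has the value `n`. -/
abbrev units (n : ℕ) : List Γ' := List.replicate n (.bit true)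

/-- Units are removed in pairs from `a` and `b`, and each pair is recorded by one unit on `tmp`; `i`
includes the unit in the register. If `b` runs out first, the unmatched unit goes back to `a` and
the flag is cleared. -/
theorem exec_compare_loop {a b : Stk T V} (hab : a ≠ b) (ha : a ≠ .tmp) (hb : b ≠ .tmp)
    (i j r : ℕ) {S : Mem T V} (hSa : S a = units (i - 1)) (hSb : S b = units j)
    (hSt : S .tmp = units r) :
    Exec (.loop (fun v => v.1 && v.2.isSome)
        (.seq (popReg b) (.ite filled (.seq (pushUnit .tmp) (popReg a))
          (.seq (pushUnit a) (.load fun v => (false, v.2))))))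
      ((true, (units i).head?), S)
      ((decide (i ≤ j), none), update (update (update S a (units (i - j))) b (units (j - i))) .tmp
        (units (r + min i j))) (5 * i + 6) := by
  induction i generalizing S j r with
  | zero =>
    refine (Exec.loop_false rfl).congr ?_ (by simp)
    congr 1
    funext k
    simp only [update_apply]
    split_ifs <;> simp_all
  | succ i ih =>
    rcases j with _ | j
    · refine (Exec.loop_true (by simp [List.replicate_succ]) (Exec.seq exec_popReg
        (Exec.ite_false (by simp [filled, hSb]) (Exec.seq exec_pushUnit (Exec.load _ _ _))))
        (Exec.loop_false (by simp))).congr ?_ (by omega)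
      simp only [hSb, Prod.mk.injEq]
      refine ⟨by simp, ?_⟩
      funext k
      simp only [update_apply]
      split_ifs <;> simp_all [List.replicate_succ]
    · refine (Exec.loop_true (by simp [List.replicate_succ]) (Exec.seq exec_popReg
        (Exec.ite_true (by simp [filled, hSb, List.replicate_succ])
          ((Exec.seq exec_pushUnit exec_popReg).congr
            (s'' := ((true, (units i).head?), update (update (update S b (units j)) .tmp
              (units (r + 1))) a (units (i - 1)))) ?_ le_rfl)))
        (ih j (r + 1) (by simp) (by simp [hab.symm, hb]) (by simp [ha.symm]))).congr ?_ ?_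
      · simp_all [hb.symm]
        funext k
        simp only [update_apply]
        split_ifs <;> simp_all [List.replicate_succ]
      · congr 1
        · simp
        · funext k
          simp only [update_apply]
          split_ifs <;> simp_all [add_assoc, add_comm 1]
      · omega

/-- Each unit on `tmp` stands for one unit taken from both counters, so it is paid back to both. -/
theorem exec_compare_restore {a b : Stk T V} (hab : a ≠ b) (ha : a ≠ .tmp) (hb : b ≠ .tmp)
    (i j r : ℕ) {f : Bool} {S : Mem T V} (hSa : S a = units i) (hSb : S b = units j)
    (hSt : S .tmp = units (r - 1)) :
    Exec (.loop filled (.seq (pushUnit a) (.seq (pushUnit b) (popReg .tmp))))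
      ((f, (units r).head?), S)
      ((f, none), update (update (update S a (units (i + r))) b (units (j + r))) .tmp [])
      (4 * r + 1) := by
  induction r generalizing S i j with
  | zero =>
    refine (Exec.loop_false rfl).congr ?_ (by simp)
    congr 1
    funext k
    simp only [update_apply]
    split_ifs <;> simp_all
  | succ r ih =>
    refine (Exec.loop_true (by simp [filled, List.replicate_succ])
      ((Exec.seq exec_pushUnit (Exec.seq exec_pushUnit exec_popReg)).congr
        (s'' := ((f, (units r).head?), update (update (update S a (units (i + 1))) b
          (units (j + 1))) .tmp (units (r - 1)))) ?_ le_rfl)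
      (ih (i + 1) (j + 1) (by simp [ha, hab]) (by simp [hb]) (by simp))).congr ?_ ?_
    · have h : update (update S a (.bit true :: S a)) b
          (.bit true :: update S a (.bit true :: S a) b) .tmp = units r := by
        simp_all [ha.symm, hb.symm]
      rw [h]
      congr 1
      funext k
      simp only [update_apply]
      split_ifs <;> simp_all [List.replicate_succ]
    · congr 1
      funext k
      simp only [update_apply]
      split_ifs <;> simp_all [add_assoc, add_comm 1]
    · omega

theorem exec_compare {a b : Stk T V} (hab : a ≠ b) (ha : a ≠ .tmp) (hb : b ≠ .tmp)
    (i j : ℕ) {f : Bool} {o : Option Γ'} {S : Mem T V} (hSa : S a = units i) (hSb : S b = units j)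
    (hSt : S .tmp = []) :
    Exec (compare a b) ((f, o), S) ((decide (i ≤ j), none), S) (9 * i + 10) := by
  have h1 := exec_compare_loop hab ha hb i j 0 (S := update S a (units (i - 1))) (by simp)
    (by simp [hSb, hab.symm]) (by simp [hSt, ha.symm])
  have h2 := exec_compare_restore hab ha hb (i - j) (j - i) (min i j) (f := decide (i ≤ j))
    (S := update (update (update S a (units (i - j))) b (units (j - i))) .tmp
      (units (min i j - 1))) (by simp [ha, hab]) (by simp [hb]) (by simp)
  refine (Exec.seq (Exec.load _ _ _) (Exec.seq (Exec.seq
    (exec_popReg.congr (s'' := ((true, (units i).head?), update S a (units (i - 1)))) ?_ le_rfl)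
    h1) (Exec.seq (exec_popReg.congr (s'' := ((decide (i ≤ j), (units (min i j)).head?), _)) ?_ le_rfl) h2))).congr ?_ (by omega)
  · simp [hSa]
  · simp
  · congr 1
    funext k
    simp only [update_apply]
    split_ifs <;> simp_all; omega

/-- `J m` describes the memory after `m` rounds as if the counter `x` were intact. While the body
runs in round `m`, its `n` units are split: `m + 1` on `tmp` and `n - m - 1` on `pos x`. The body
must leave both in place. -/
theorem exec_repeatPos {x : V} {body : Prog T V} (n : ℕ) (f : ℕ → Bool) (J : ℕ → Mem T V)
    {o : Option Γ'} {t : ℕ} (hpos : ∀ m ≤ n, J m (.pos x) = units n) (htmp : ∀ m ≤ n, J m .tmp = [])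
    (h : ∀ m < n, ∃ o, Exec body
      ((f m, some (.bit true)),
        update (update (J m) (.pos x) (units (n - m - 1))) .tmp (units (m + 1)))
      ((f (m + 1), o),
        update (update (J (m + 1)) (.pos x) (units (n - m - 1))) .tmp (units (m + 1))) t) :
    Exec (repeatPos x body) ((f 0, o), J 0) ((f n, none), J n) (n * (t + 6) + 4) := by
  have hl := Exec.iterate (p := filled) (a := .seq (.seq (pushUnit .tmp) body) (popReg (.pos x)))
    (fun m => ((f m, (units (n - m)).head?),
      update (update (J m) (.pos x) (units (n - m - 1))) .tmp (units m))) (t := t + 2) n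
    (by simp [filled]) (by
      intro m hm
      obtain ⟨o, ho⟩ := h m hm
      refine ⟨by simp [filled]; omega, ?_⟩
      obtain ⟨d, rfl⟩ : ∃ d, n = m + 1 + d := ⟨n - (m + 1), by omega⟩
      have e1 : m + 1 + d - m - 1 = d := by omega
      have e2 : m + 1 + d - m = d + 1 := by omega
      have e3 : m + 1 + d - (m + 1) = d := by omega
      rw [e1] at ho
      simp only [e2, e3]
      refine (Exec.seq (Exec.seq (exec_pushUnit.congr ?_ le_rfl) ho) exec_popReg).congr ?_
        (by omega)
      · simp [List.replicate_succ]
      · simp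
        funext k
        simp only [update_apply]
        split_ifs <;> simp_all)
  have h0 := hpos 0 (by omega)
  have h0' := htmp 0 (by omega)
  have hn := hpos n le_rfl
  have hn' := htmp n le_rfl
  refine (Exec.seq (Exec.seq (exec_popReg.congr ?_ le_rfl) hl) (exec_move (by simp))).congr ?_ ?_
  · simp [h0, h0']
  · simp
    funext k
    simp only [update_apply]
    split_ifs <;> simp_all
  · simp; linarith

theorem exec_nextWord_loop {t : T} {f : Bool} (w rest : List Γ') (hw : Γ'.comma ∉ w)
    {S : Mem T V} (hS : S (.right t) = (w ++ .comma :: rest).tail) :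
    Exec (.loop (fun v => v.2 ≠ some .comma) (.seq (pushReg (.left t)) (popReg (.right t))))
      ((f, (w ++ .comma :: rest).head?), S)
      ((f, some .comma), update (update S (.right t) rest) (.left t) (w.reverse ++ S (.left t)))
      (3 * w.length + 1) := by
  induction w generalizing S with
  | nil =>
    have h : update S (.right t) rest = S := update_eq_self_iff.2 (by simpa using hS.symm)
    exact (Exec.loop_false (by simp)).congr (by simp [h]) (by simp)
  | cons c w ih =>
    have hc : c ≠ .comma := by rintro rfl; simp at hw
    refine (Exec.loop_true (by simpa using hc) ((Exec.seq exec_pushReg exec_popReg).congr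
      (s'' := ((f, (w ++ .comma :: rest).head?), update (update S (.left t) (c :: S (.left t)))
        (.right t) (w ++ .comma :: rest).tail)) ?_ le_rfl)
      (ih (by simp_all) (by simp))).congr ?_ ?_
    · simp_all
    · congr 1
      funext k
      simp only [update_apply]
      split_ifs <;> simp_all
    · simp; omega

theorem exec_nextWord {t : T} {f : Bool} {o : Option Γ'} (w rest : List Γ') (hw : Γ'.comma ∉ w)
    {S : Mem T V} (hS : S (.right t) = w ++ .comma :: rest) :
    Exec (nextWord t) ((f, o), S)
      ((f, some .comma),
        update (update S (.right t) rest) (.left t) (.comma :: w.reverse ++ S (.left t)))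
      (3 * w.length + 3) := by
  refine (Exec.seq exec_popReg (Exec.seq (hS ▸ exec_nextWord_loop w rest hw (by simp [hS]))
    exec_pushReg)).congr ?_ (by omega)
  congr 1
  funext k
  simp only [update_apply]
  split_ifs <;> simp_all

theorem exec_nextSymbol_of_lt {t : T} {f : Bool} {o : Option Γ'} {c : Γ'} {l : List Γ'}
    (hc : c ≠ .comma) {S : Mem T V} (hS : S (.right t) = c :: l) :
    Exec (nextSymbol t) ((f, o), S)
      ((f, some c), update (update S (.right t) l) (.left t) (c :: S (.left t))) 3 := by
  refine (Exec.seq (exec_popReg.congr (s'' := ((f, some c), update S (.right t) l)) ?_ le_rfl)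
    (Exec.ite_false (by simpa using hc) exec_pushReg)).congr ?_ (by omega)
  · simp [hS]
  · simp

theorem exec_nextSymbol_of_le {t : T} {f : Bool} {o : Option Γ'} {l : List Γ'}
    {S : Mem T V} (hS : S (.right t) = .comma :: l) :
    Exec (nextSymbol t) ((f, o), S) ((false, some .comma), S) 4 := by
  refine (Exec.seq (exec_popReg.congr (s'' := ((f, some .comma), update S (.right t) l)) ?_ le_rfl)
    (Exec.ite_true (by simp) (Exec.seq exec_pushReg (Exec.load _ _ _)))).congr ?_ (by omega)
  · simp [hS]
  · simp [← hS]

theorem delimit_append (L M : List (List Γ')) : delimit (L ++ M) = delimit L ++ delimit M := by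
  simp [delimit]

theorem delimit_cons (w : List Γ') (L : List (List Γ')) :
    delimit (w :: L) = w ++ .comma :: delimit L := by
  simp [delimit]

theorem length_le_length_delimit (L : List (List Γ')) : L.length ≤ (delimit L).length := by
  induction L with
  | nil => simp
  | cons w L ih => simp [delimit_cons]; omega

theorem exists_drop_take_eq {α : Type} {l : List α} {m : ℕ} (hm : m < l.length) :
    ∃ a ∈ l, l[m] = a ∧ l.drop m = a :: l.drop (m + 1) ∧ l.take (m + 1) = l.take m ++ [a] :=
  ⟨l[m], List.getElem_mem _, rfl, List.drop_eq_getElem_cons hm, by simp⟩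

/-- The hypothesis `hi` guarantees that every call of `nextWord` finds a comma; at the end of the
tape its loop would never stop. -/
theorem exec_repeatPos_nextWord {t : T} {x : V} {f : Bool} {o : Option Γ'} {S : Mem T V}
    (W : List (List Γ')) (hW : ∀ w ∈ W, Γ'.comma ∉ w) (hl : S (.left t) = [])
    (hr : S (.right t) = delimit W) (htmp : S .tmp = []) (i : ℕ) (hx : S (.pos x) = units i)
    (hi : i < W.length) {L : ℕ} (hL : (delimit W).length ≤ L) :
    Exec (repeatPos x (nextWord t)) ((f, o), S)
      ((f, none), update (update S (.right t) (delimit (W.drop i))) (.left t)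
        (delimit (W.take i)).reverse) (i * (3 * L + 9) + 4) := by
  have h1 := exec_repeatPos (x := x) (body := nextWord t) (o := o) i (fun _ => f)
    (fun m => update (update S (.right t) (delimit (W.drop m))) (.left t)
      (delimit (W.take m)).reverse) (t := 3 * L + 3) (by simp [hx]) (by simp [htmp])
    (by
      intro m hm
      obtain ⟨w, hw, -, e1, e2⟩ := exists_drop_take_eq (show m < W.length by omega)
      refine ⟨some .comma, (exec_nextWord w (delimit (W.drop (m + 1))) (hW _ hw) ?_).congr ?_ ?_⟩
      · simp only [e1, delimit_cons]
        simp
      · congr 1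
        simp only [e2, delimit_append, delimit_cons]
        funext k
        simp only [update_apply]
        split_ifs <;> simp_all [delimit]
      · have := congrArg (fun l => (delimit l).length) (List.take_append_drop m W)
        simp only [e1, delimit_append, delimit_cons, List.length_append, List.length_cons] at this
        omega)
  convert h1 using 2
  rw [List.drop_zero, ← hr, List.take_zero]
  funext k
  simp only [update_apply]
  split_ifs <;> simp_all [delimit]

/-- The head never passes the comma that ends the word: a call made there only clears the flag. -/
theorem exec_repeatPos_nextSymbol {t : T} {y : V} {o : Option Γ'} {S : Mem T V}
    (w rest before : List Γ') (hw : .comma ∉ w) (htmp : S .tmp = []) (j : ℕ)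
    (hl : S (.left t) = before) (hr : S (.right t) = w ++ .comma :: rest)
    (hy : S (.pos y) = units j) :
    Exec (repeatPos y (nextSymbol t)) ((true, o), S)
      ((decide (j ≤ w.length), none), update (update S (.right t) (w.drop j ++ .comma :: rest))
        (.left t) ((w.take j).reverse ++ before)) (j * 10 + 4) := by
  have h2 := exec_repeatPos (x := y) (body := nextSymbol t) (o := o) j
    -- Equality is allowed, since `w.length` moves lead exactly to the comma, which counts as a
    -- readable symbol.
    (fun m => decide (m ≤ w.length))
    (fun m => update (update S (.right t) (w.drop m ++ .comma :: rest)) (.left t)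
      ((w.take m).reverse ++ before)) (t := 4) (by simp [hy]) (by simp [htmp])
    (by
      intro m hm
      rcases lt_or_ge m w.length with hm' | hm'
      · obtain ⟨a, ha, -, e1, e2⟩ := exists_drop_take_eq hm'
        have hc : a ≠ .comma := fun h => hw (h ▸ ha)
        refine ⟨some a, (exec_nextSymbol_of_lt hc (l := w.drop (m + 1) ++ .comma :: rest)
          ?_).congr ?_ (by omega)⟩
        · simp only [e1]
          simp
        · congr 1
          · simp; omega
          · simp only [e2]
            funext k
            simp only [update_apply]
            split_ifs <;> simp_all
      · refine ⟨some .comma, (exec_nextSymbol_of_le (l := rest) ?_).congr ?_ (by omega)⟩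
        · simp [List.drop_eq_nil_of_le hm']
        · rw [List.drop_eq_nil_of_le hm', List.drop_eq_nil_of_le (by omega : w.length ≤ m + 1),
            List.take_of_length_le hm', List.take_of_length_le (by omega : w.length ≤ m + 1)]
          congr 2
          simp; omega)
  convert h2 using 2
  · simp
  rw [List.drop_zero, List.take_zero]
  funext k
  simp only [update_apply]
  split_ifs <;> simp_all

theorem exec_lookup {t : T} {x y : V} {c : Γ'} {f : Bool} {o : Option Γ'} {S : Mem T V}
    (W : List (List Γ')) (hW : ∀ w ∈ W, Γ'.comma ∉ w) (hl : S (.left t) = [])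
    (hr : S (.right t) = delimit W) (htmp : S .tmp = []) (i j : ℕ) (hx : S (.pos x) = units i)
    (hy : S (.pos y) = units j) (hi : i < W.length) {L : ℕ} (hL : (delimit W).length ≤ L)
    (hj : j ≤ L) :
    Exec (lookup t x y c) ((f, o), S)
      ((decide ((W[i] ++ [.comma])[j]? = some c), none), S) (3 * L * L + 22 * L + 14) := by
  obtain ⟨w, hw, hwi, e1, e2⟩ := exists_drop_take_eq hi
  have h1 := exec_repeatPos_nextWord (f := f) (o := o) W hW hl hr htmp i hx hi hL
  rw [e1, delimit_cons] at h1
  obtain ⟨rest, hrest⟩ : ∃ rest, delimit (W.drop (i + 1)) = rest := ⟨_, rfl⟩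
  obtain ⟨before, hbefore⟩ : ∃ l, delimit (W.take i) = l := ⟨_, rfl⟩
  have hall : delimit W = before ++ w ++ .comma :: rest := by
    rw [← List.take_append_drop i W, delimit_append, e1, delimit_cons, hrest, hbefore]
    simp
  rw [hrest, hbefore] at h1
  have h2 := exec_repeatPos_nextSymbol (t := t) (y := y) (o := none)
    (S := update (update S (.right t) (w ++ .comma :: rest)) (.left t) before.reverse) w rest
    before.reverse (hW _ hw) (by simp [htmp]) j (by simp) (by simp) (by simp [hy])
  obtain ⟨a, l, hal⟩ : ∃ a l, w.drop j ++ .comma :: rest = a :: l := by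
    cases w.drop j <;> simp
  -- Three cases: the position lies inside the word, on its comma, or beyond it. In the last case
  -- the head rests on the comma, and only the cleared flag prevents a false match.
  have hflag : (decide (j ≤ w.length) && decide (some a = some c)) =
      decide ((W[i] ++ [.comma])[j]? = some c) := by
    rw [hwi, ← Bool.decide_and, decide_eq_decide]
    rcases lt_trichotomy j w.length with h | h | h
    · rw [List.drop_eq_getElem_cons h] at hal
      simp only [List.cons_append, List.cons.injEq] at hal
      simp [h, h.le, hal.1]
    · subst h
      simp at hal
      simp [hal.1]
    · simp [h.not_ge]
  rw [← hflag]
  refine (Exec.seq h1 <| Exec.seq (Exec.load _ _ _) <| Exec.seq h2 <| Exec.seq (exec_popReg.congr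
    (s'' := ((decide (j ≤ w.length), some a), update (update S (.right t) l) (.left t)
        ((w.take j).reverse ++ before.reverse))) ?_ le_rfl) <|
    Exec.seq exec_pushReg <| Exec.seq (Exec.load _ _ _) (exec_move (by simp))).congr ?_ ?_
  · simp only [hal]
    congr 1
    · simp
    · funext k
      simp only [update_apply]
      split_ifs <;> simp_all
  · congr 1
    have : before ++ (w.take j ++ (a :: l)) = S (.right t) := by
      rw [← hal, hr, hall, ← List.append_assoc (w.take j), List.take_append_drop,
        List.append_assoc]
    funext k
    simp only [update_apply]
    split_ifs <;> simp_all
  · have hi' : i ≤ L := (hi.le.trans (length_le_length_delimit W)).trans hL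
    have h3 : i * (3 * L + 9) ≤ L * (3 * L + 9) := Nat.mul_le_mul_right _ hi'
    have h4 := congrArg List.length hall
    simp at h4 ⊢
    have : min j w.length ≤ w.length := min_le_right _ _
    nlinarith

/-- In round `m` the counter `x` has the value `m`: units pass one at a time from `rem x` to `pos
x`, and successes of the body are tallied on `acc x`. Afterwards everything is put back, so the same
variable can be quantified again later. -/
theorem exec_countLe {x y : V} {body : Prog T V} {f : Bool} {o : Option Γ'}
    {S : Mem T V} (n c : ℕ) (g : ℕ → Bool) (hpos : S (.pos x) = []) (hrem : S (.rem x) = units n)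
    (hacc : S (.acc x) = []) (htmp : S .tmp = []) (hy : S (.pos y) = units c) {t : ℕ}
    (h : ∀ m < n, ∀ a f o, Exec body
      ((f, o), update (update (update S (.pos x) (units m)) (.rem x) (units (n - m - 1)))
        (.acc x) (units a))
      ((g m, none), update (update (update S (.pos x) (units m)) (.rem x) (units (n - m - 1)))
        (.acc x) (units a)) t) :
    Exec (countLe x body y) ((f, o), S) ((decide (Nat.count (fun m => g m = true) n ≤ c), none), S)
      (n * (t + 20) + 20) := by
  -- `F m` is the flag on entry to round `m`: the original flag, then the verdict of the previous
  -- round.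
  obtain ⟨F, hF0, hF⟩ : ∃ F : ℕ → Bool, F 0 = f ∧ ∀ m, F (m + 1) = g m :=
    ⟨fun m => Nat.casesOn m f g, rfl, fun _ => rfl⟩
  have hl := Exec.iterate (p := filled) (a := .seq body (.seq (.ite Prod.fst (pushUnit (.acc x))
    (.load id)) (.seq (pushUnit (.pos x)) (popReg (.rem x)))))
    (fun m => ((F m, (units (n - m)).head?),
      update (update (update S (.pos x) (units m)) (.rem x) (units (n - m - 1))) (.acc x)
        (units (Nat.count (fun m => g m = true) m)))) (t := t + 4) n
    (by simp [filled]) (by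
      intro m hm
      obtain ⟨d, rfl⟩ : ∃ d, n = m + 1 + d := ⟨n - (m + 1), by omega⟩
      have hb := h m hm (Nat.count (fun m => g m = true) m) (F m) (some (.bit true))
      have e1 : m + 1 + d - m - 1 = d := by omega
      have e2 : m + 1 + d - m = d + 1 := by omega
      have e3 : m + 1 + d - (m + 1) = d := by omega
      simp only [e1] at hb
      simp only [e2, e3]
      refine ⟨by simp [filled, List.replicate_succ], ?_⟩
      refine (Exec.seq hb (Exec.seq (s' := ((g m, none), update (update (update S (.pos x)
        (units m)) (.rem x) (units d)) (.acc x) (units (Nat.count (fun m => g m = true) (m + 1)))))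
        (t := 2) ?_ (Exec.seq exec_pushUnit exec_popReg))).congr ?_ (by omega)
      · rcases Bool.eq_false_or_eq_true (g m) with hg | hg
        rotate_left
        · refine (Exec.ite_false (p := Prod.fst) (v := (g m, none)) hg (Exec.load id _ _)).congr ?_ le_rfl
          simp [Nat.count_succ, hg]
        · refine (Exec.ite_true (p := Prod.fst) (v := (g m, none)) hg exec_pushUnit).congr ?_ le_rfl
          simp [Nat.count_succ, hg, List.replicate_succ]
      · congr 1
        · simp [hF]
        · funext k
          simp only [update_apply]
          split_ifs <;> simp_all [List.replicate_succ])
  have hcount : Nat.count (fun m => g m = true) n ≤ n := Nat.count_le _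
  obtain ⟨a, ha⟩ : ∃ a, Nat.count (fun m => g m = true) n = a := ⟨_, rfl⟩
  rw [ha] at hl hcount ⊢
  refine (Exec.seq (Exec.seq (exec_popReg.congr ?_ le_rfl) hl) <| Exec.seq ((exec_move
    (by simp)).congr (s'' := ((F n, none), update S (.acc x) (units a))) ?_ le_rfl) <|
    Exec.seq (exec_compare (by simp) (by simp) (by simp) a c (by simp) (by simp [hy])
    (by simp [htmp])) exec_clear).congr ?_ ?_
  · simp only [hrem, hF0]
    congr 1
    funext k
    simp only [update_apply]
    split_ifs <;> simp_all
  · simp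
    funext k
    simp only [update_apply]
    split_ifs <;> simp_all
  · simp [← hacc]
  · simp
    nlinarith

end Prog

end DisjointPaths

/-! ### First-order formulas with counting and their evaluation -/

namespace DisjointPaths

open Turing Function StackProg

/-- Formulas about words on tapes in `T`, with variables in `V` that range over natural numbers:
first-order logic with counting. -/
inductive CountFormula (T V : Type)
  | symbol (t : T) (x y : V) (c : Γ')
  | le (x y : V)
  | not (φ : CountFormula T V)
  | and (φ ψ : CountFormula T V)
  | countLe (x : V) (φ : CountFormula T V) (y : V)

namespace CountFormula

variable {T V : Type}

/-- Does the formula contain a quantification over `z`? -/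
def Binds (z : V) : CountFormula T V → Prop
  | symbol _ _ _ _ => False
  | le _ _ => False
  | not φ => φ.Binds z
  | and φ ψ => φ.Binds z ∨ ψ.Binds z
  | countLe x φ _ => z = x ∨ φ.Binds z

/-- The program that decides the formula. -/
def toProg : CountFormula T V → Prog T V
  | symbol t x y c => Prog.lookup t x y c
  | le x y => Prog.compare (.pos x) (.pos y)
  | not φ => .seq φ.toProg (.load fun v => (!v.1, v.2))
  | and φ ψ => .seq φ.toProg (.ite Prod.fst ψ.toProg (.load id))
  | countLe x φ y => Prog.countLe x φ.toProg y

/-- A bound for the running time of the program that decides the formula. -/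
noncomputable def cost : CountFormula T V → Polynomial ℕ
  | symbol _ _ _ _ => 3 * .X * .X + 22 * .X + 14
  | le _ _ => 9 * .X + 10
  | not φ => φ.cost + 1
  | and φ ψ => φ.cost + ψ.cost + 2
  | countLe _ φ _ => .X * (φ.cost + 20) + 20

variable [DecidableEq V]

/-- The truth value of a formula, for the words `W t` on the tapes and the bounds `bnd` for the
quantified variables. A word is followed by a comma. -/
def eval (W : T → List (List Γ')) (bnd : V → ℕ) : CountFormula T V → (V → ℕ) → Bool
  | symbol t x y c, e => decide ((((W t)[e x]?.getD []) ++ [.comma])[e y]? = some c)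
  | le x y, e => decide (e x ≤ e y)
  | not φ, e => !φ.eval W bnd e
  | and φ ψ, e => φ.eval W bnd e && ψ.eval W bnd e
  | countLe x φ y, e =>
    decide (Nat.count (fun m => φ.eval W bnd (update e x m) = true) (bnd x) ≤ e y)

/-- All accesses to tapes are in their range, and all quantified variables are fresh. -/
def Proper (W : T → List (List Γ')) (bnd : V → ℕ) : CountFormula T V → (V → ℕ) → Prop
  | symbol t x _ _, e => e x < (W t).length
  | le x y, _ => x ≠ y
  | not φ, e => φ.Proper W bnd e
  | and φ ψ, e => φ.Proper W bnd e ∧ ψ.Proper W bnd e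
  | countLe x φ _, e => ¬φ.Binds x ∧ ∀ m < bnd x, φ.Proper W bnd (update e x m)

/-- Induction on the formula, with the memory restored by every subprogram. Only bound variables
need to start at 0 with a full remainder. `Proper` forbids nested quantification over one variable,
but disjoint subformulas may share it. -/
theorem exec_toProg [DecidableEq T] {W : T → List (List Γ')} {bnd : V → ℕ} {L : ℕ}
    (hW : ∀ t, ∀ w ∈ W t, Γ'.comma ∉ w) (hL : ∀ t, (delimit (W t)).length ≤ L)
    (hbnd : ∀ x, bnd x ≤ L) (φ : CountFormula T V) {e : V → ℕ} {S : Mem T V} {f : Bool}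
    {o : Option Γ'} (hpos : ∀ x, S (.pos x) = Prog.units (e x))
    (hb : ∀ x, φ.Binds x → e x = 0 ∧ S (.rem x) = Prog.units (bnd x) ∧ S (.acc x) = [])
    (htmp : S .tmp = []) (hleft : ∀ t, S (.left t) = [])
    (hright : ∀ t, S (.right t) = delimit (W t)) (hp : φ.Proper W bnd e) (he : ∀ x, e x ≤ L) :
    Exec φ.toProg ((f, o), S) ((φ.eval W bnd e, none), S) (φ.cost.eval L) := by
  induction φ generalizing e S f o with
  | symbol t x y c =>
    refine (Prog.exec_lookup (W t) (hW t) (hleft t) (hright t) htmp (e x) (e y) (hpos x) (hpos y) hp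
      (hL t) (he y)).congr ?_ (by simp [cost])
    have : e x < (W t).length := hp
    rw [eval, List.getElem?_eq_getElem this, Option.getD_some]
    congr!
  | le x y =>
    refine (Prog.exec_compare (by simpa using (show x ≠ y from hp)) (by simp) (by simp) (e x) (e y) (hpos x) (hpos y)
      htmp).mono ?_
    have := he x
    simp [cost]
    omega
  | not φ ih =>
    exact (Exec.seq (ih hpos hb htmp hleft hright hp he) (Exec.load _ _ _)).congr rfl
      (by simp [cost])
  | and φ ψ ihφ ihψ =>
    have h1 := ihφ (f := f) (o := o) hpos (fun x hx => hb x (Or.inl hx)) htmp hleft hright hp.1 he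
    have h2 := ihψ (f := φ.eval W bnd e) (o := none) hpos (fun x hx => hb x (Or.inr hx)) htmp hleft
      hright hp.2 he
    rcases Bool.eq_false_or_eq_true (φ.eval W bnd e) with h | h
    · refine (Exec.seq h1 (Exec.ite_true (p := Prod.fst) h h2)).congr ?_ ?_
      · simp [eval, h]
      · simp [cost]; omega
    · refine (Exec.seq h1 (Exec.ite_false (p := Prod.fst) h (Exec.load id _ _))).congr ?_ ?_
      · simp [eval, h]
      · simp [cost]
  | countLe x φ y ih =>
    obtain ⟨hx0, hxr, hxa⟩ := hb x (Or.inl rfl)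
    refine (Prog.exec_countLe (bnd x) (e y) (fun m => φ.eval W bnd (update e x m))
      (by simp [hpos, hx0]) hxr hxa htmp (hpos y) (t := φ.cost.eval L) ?_).mono ?_
    · intro m hm a f o
      refine ih ?_ ?_ (by simp [htmp]) (by simp [hleft]) (by simp [hright]) (hp.2 m hm) ?_
      · intro z
        by_cases hz : z = x
        · subst hz; simp
        · simp [hz, hpos]
      · intro z hz
        have hzx : z ≠ x := by rintro rfl; exact hp.1 hz
        simpa [hzx] using hb z (Or.inr hz)
      · intro z
        by_cases hz : z = x
        · subst hz; simp; exact hm.le.trans (hbnd _)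
        · simp [hz, he]
    · simp only [cost, Polynomial.eval_add, Polynomial.eval_mul, Polynomial.eval_X,
        Polynomial.eval_ofNat]
      gcongr
      exact hbnd x

end CountFormula

end DisjointPaths

/-! ### Reading the input and running the decision procedure -/

namespace DisjointPaths

open Turing Function StackProg

/-- The tapes of the decision procedure: the rows of the adjacency matrix, and the first and the
second vertices of the terminal pairs. -/
inductive Tape
  | adj
  | src
  | tgt
  deriving DecidableEq

instance : Fintype Tape := ⟨{.adj, .src, .tgt}, fun t => by cases t <;> simp⟩

/-- The variables of the decision procedure. -/
inductive Var
  | c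
  | w
  | u
  | v
  | i
  | j
  | zero
  deriving DecidableEq

instance : Fintype Var :=
  ⟨{.c, .w, .u, .v, .i, .j, .zero}, fun x => by cases x <;> simp⟩

/-- The bounds for the variables in an instance with `n` vertices and `k` pairs: `c`, `w`, `u`, `v`
range over vertices, and `i`, `j` over indices of pairs. -/
def Var.bound (n k : ℕ) : Var → ℕ
  | c => n
  | w => n
  | u => n
  | v => n
  | i => k
  | j => k
  | zero => 0

/-- The words on the tapes, for the rows `R` and the pairs `X` of words. -/
def tapeWords (R : List (List Γ')) (X : List (List Γ' × List Γ')) : Tape → List (List Γ')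
  | .adj => R
  | .src => X.map Prod.fst
  | .tgt => X.map Prod.snd

namespace Prog

/-- The contents of the stacks while the input is read. -/
def readMem (inp : List Γ') (l : Tape → List Γ') (n k : ℕ) : Mem Tape Var
  | .inp => inp
  | .left t => l t
  | .rem x => units (x.bound n k)
  | _ => []

/-- The contents of the stacks when the input has been read. -/
def workMem (r : Tape → List Γ') (n k : ℕ) : Mem Tape Var
  | .right t => r t
  | .rem x => units (x.bound n k)
  | _ => []

/-- Note that there is another vertex. -/
def addVertex : Prog Tape Var :=
  .seq (pushUnit (.rem .c)) (.seq (pushUnit (.rem .w)) (.seq (pushUnit (.rem .u))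
    (pushUnit (.rem .v))))

/-- Note that there is another pair. -/
def addPair : Prog Tape Var := .seq (pushUnit (.rem .i)) (pushUnit (.rem .j))

/-- Move the rows of the adjacency matrix to their tape. -/
def readRows : Prog Tape Var :=
  .seq (popReg .inp) (.loop (fun v => v.2 ≠ some .bra) (.seq
    (.ite (fun v => v.2 = some .comma) addVertex (.load id))
    (.seq (pushReg (.left .adj)) (popReg .inp))))

/-- Move a word to the tape `t`. -/
def readWord (t : Tape) : Prog Tape Var :=
  .seq (.loop (fun v => v.2 ≠ some .comma) (.seq (pushReg (.left t)) (popReg .inp)))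
    (.seq (pushReg (.left t)) (popReg .inp))

/-- Move the pairs to their tapes. -/
def readPairs : Prog Tape Var :=
  .seq (popReg .inp) (.loop filled (.seq (readWord .src) (.seq (readWord .tgt) addPair)))

/-- Distribute the input to the tapes, and initialize the counters. -/
def readInput : Prog Tape Var :=
  .seq readRows (.seq readPairs (.seq (move (.left .adj) (.right .adj))
    (.seq (move (.left .src) (.right .src)) (move (.left .tgt) (.right .tgt)))))

theorem exec_addVertex {v : Reg} {inp : List Γ'} {l : Tape → List Γ'} {n k : ℕ} :
    Exec addVertex (v, readMem inp l n k) (v, readMem inp l (n + 1) k) 4 := by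
  refine (Exec.seq exec_pushUnit <| Exec.seq exec_pushUnit <| Exec.seq exec_pushUnit
    exec_pushUnit).congr ?_ le_rfl
  congr 1
  funext s
  rcases s with _ | _ | t | t | x | x | x <;> try rfl
  cases x <;> rfl

theorem exec_addPair {v : Reg} {inp : List Γ'} {l : Tape → List Γ'} {n k : ℕ} :
    Exec addPair (v, readMem inp l n k) (v, readMem inp l n (k + 1)) 2 := by
  refine (Exec.seq exec_pushUnit exec_pushUnit).congr ?_ le_rfl
  congr 1
  funext s
  rcases s with _ | _ | t | t | x | x | x <;> try rfl
  cases x <;> rfl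

theorem exec_transfer {f : Bool} {inp : List Γ'} {l : Tape → List Γ'} {n k : ℕ} {a : Γ'} {t : Tape} :
    Exec (.seq (pushReg (.left t)) (popReg .inp)) ((f, some a), readMem inp l n k)
      ((f, inp.head?), readMem inp.tail (update l t (a :: l t)) n k) 2 := by
  refine (Exec.seq exec_pushReg exec_popReg).congr ?_ le_rfl
  congr 1
  funext s
  rcases s with _ | _ | t' | t' | x | x | x <;> try simp [readMem]
  by_cases h : t' = t
  · subst h; simp
  · simp [h, readMem]

/-- Each row ends with a comma, so raising the vertex bounds at every comma yields the number of
rows. The tape is built in reverse and turned around at the end of `readInput`. -/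
theorem exec_readRows_loop {f : Bool} (r rest : List Γ') (hr : .bra ∉ r) {l : Tape → List Γ'}
    {n k : ℕ} :
    Exec (.loop (fun v => v.2 ≠ some .bra) (.seq
        (.ite (fun v => v.2 = some .comma) addVertex (.load id))
        (.seq (pushReg (.left .adj)) (popReg .inp))))
      ((f, (r ++ .bra :: rest).head?), readMem (r ++ .bra :: rest).tail l n k)
      ((f, some .bra), readMem rest (update l .adj (r.reverse ++ l .adj)) (n + r.count .comma) k)
      (8 * r.length + 1) := by
  induction r generalizing l n with
  | nil => exact (Exec.loop_false (by simp)).congr (by simp) (by simp)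
  | cons a r ih =>
    simp only [List.mem_cons, not_or] at hr
    have hi : Exec (.ite (fun v => v.2 = some .comma) addVertex (.load id))
        ((f, some a), readMem (r ++ .bra :: rest) l n k)
        ((f, some a), readMem (r ++ .bra :: rest) l (n + if a = .comma then 1 else 0) k) 5 := by
      by_cases ha : a = .comma
      · exact (Exec.ite_true (by simpa using ha) exec_addVertex).congr (by simp [ha]) le_rfl
      · exact (Exec.ite_false (by simpa using ha) (Exec.load id _ _)).congr (by simp [ha])
          (by omega)
    refine (Exec.loop_true (by simpa using Ne.symm hr.1) (Exec.seq hi exec_transfer)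
      (ih hr.2)).congr ?_ (by simp; omega)
    congr 2
    · simp
    · simp only [List.count_cons, beq_iff_eq]; omega

theorem exec_readRows {v : Reg} (r rest : List Γ') (hr : .bra ∉ r) {l : Tape → List Γ'} {n k : ℕ} :
    Exec readRows (v, readMem (r ++ .bra :: rest) l n k)
      ((v.1, some .bra), readMem rest (update l .adj (r.reverse ++ l .adj)) (n + r.count .comma) k)
      (8 * r.length + 2) := by
  refine (Exec.seq (exec_popReg.congr ?_ le_rfl) (exec_readRows_loop r rest hr)).congr rfl
    (by omega)
  congr 1
  funext s
  rcases s with _ | _ | t' | t' | x | x | x <;> simp [readMem]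

theorem exec_readWord_loop {f : Bool} {t : Tape} (r rest : List Γ') (hr : .comma ∉ r)
    {l : Tape → List Γ'} {n k : ℕ} :
    Exec (.loop (fun v => v.2 ≠ some .comma) (.seq (pushReg (.left t)) (popReg .inp)))
      ((f, (r ++ .comma :: rest).head?), readMem (r ++ .comma :: rest).tail l n k)
      ((f, some .comma), readMem rest (update l t (r.reverse ++ l t)) n k)
      (3 * r.length + 1) := by
  induction r generalizing l with
  | nil => exact (Exec.loop_false (by simp)).congr (by simp) (by simp)
  | cons a r ih =>
    simp only [List.mem_cons, not_or] at hr
    exact (Exec.loop_true (by simpa using Ne.symm hr.1) exec_transfer (ih hr.2)).congr (by simp)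
      (by simp; omega)

theorem exec_readWord {f : Bool} {t : Tape} (r rest : List Γ') (hr : .comma ∉ r)
    {l : Tape → List Γ'} {n k : ℕ} :
    Exec (readWord t)
      ((f, (r ++ .comma :: rest).head?), readMem (r ++ .comma :: rest).tail l n k)
      ((f, rest.head?), readMem rest.tail (update l t (.comma :: r.reverse ++ l t)) n k)
      (3 * r.length + 3) :=
  (Exec.seq (exec_readWord_loop r rest hr) exec_transfer).congr (by simp) (by omega)

theorem exec_readPairs_loop {f : Bool} (X : List (List Γ' × List Γ'))
    (hX : ∀ p ∈ X, Γ'.comma ∉ p.1 ∧ Γ'.comma ∉ p.2) {l : Tape → List Γ'} {n k : ℕ} :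
    Exec (.loop filled (.seq (readWord .src) (.seq (readWord .tgt) addPair)))
      ((f, (delimit (X.flatMap fun p => [p.1, p.2])).head?),
        readMem (delimit (X.flatMap fun p => [p.1, p.2])).tail l n k)
      ((f, none), readMem []
        (update (update l .src ((delimit (X.map Prod.fst)).reverse ++ l .src))
          .tgt ((delimit (X.map Prod.snd)).reverse ++ l .tgt)) n (k + X.length))
      (5 * (delimit (X.flatMap fun p => [p.1, p.2])).length + 1) := by
  induction X generalizing l k with
  | nil => exact (Exec.loop_false (by simp [filled, delimit])).congr (by simp [delimit]) (by simp)
  | cons p X ih =>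
    obtain ⟨h1, h2⟩ := hX p (by simp)
    have e : delimit ((p :: X).flatMap fun p => [p.1, p.2]) =
        p.1 ++ .comma :: (p.2 ++ .comma :: delimit (X.flatMap fun p => [p.1, p.2])) := by
      simp [delimit]
    rw [e]
    refine (Exec.loop_true (by cases p.1 <;> simp [filled]) (Exec.seq (exec_readWord p.1 _ h1)
      (Exec.seq (exec_readWord p.2 _ h2) exec_addPair))
      (ih fun q hq => hX q (by simp [hq]))).congr ?_ (by simp; omega)
    congr 2
    · funext t
      cases t <;> simp [delimit_cons]
    · simp; omega

theorem exec_readPairs {v : Reg} (X : List (List Γ' × List Γ'))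
    (hX : ∀ p ∈ X, Γ'.comma ∉ p.1 ∧ Γ'.comma ∉ p.2) {l : Tape → List Γ'} {n k : ℕ} :
    Exec readPairs (v, readMem (delimit (X.flatMap fun p => [p.1, p.2])) l n k)
      ((v.1, none), readMem []
        (update (update l .src ((delimit (X.map Prod.fst)).reverse ++ l .src))
          .tgt ((delimit (X.map Prod.snd)).reverse ++ l .tgt)) n (k + X.length))
      (5 * (delimit (X.flatMap fun p => [p.1, p.2])).length + 2) := by
  refine (Exec.seq (exec_popReg.congr ?_ le_rfl) (exec_readPairs_loop X hX)).congr rfl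
    (by omega)
  congr 1
  funext s
  rcases s with _ | _ | t' | t' | x | x | x <;> simp [readMem]

theorem count_comma_delimit (R : List (List Γ')) (hR : ∀ w ∈ R, Γ'.comma ∉ w) :
    (delimit R).count .comma = R.length := by
  induction R with
  | nil => rfl
  | cons w R ih =>
    rw [delimit_cons, List.count_append, List.count_cons, ih fun w hw => hR w (by simp [hw]),
      List.count_eq_zero_of_not_mem (hR w (by simp))]
    simp

theorem length_delimit_tapeWords_le (R : List (List Γ')) (X : List (List Γ' × List Γ')) (t : Tape) :
    (delimit (tapeWords R X t)).length ≤
      (delimit R ++ .bra :: delimit (X.flatMap fun p => [p.1, p.2])).length := by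
  have h : (delimit (X.map Prod.fst)).length + (delimit (X.map Prod.snd)).length =
      (delimit (X.flatMap fun p => [p.1, p.2])).length := by
    induction X with
    | nil => rfl
    | cons p X ih => simp [delimit_cons] at ih ⊢; omega
  cases t <;> simp [tapeWords] <;> omega

theorem exec_readInput {v : Reg} (R : List (List Γ')) (X : List (List Γ' × List Γ'))
    (hR : ∀ w ∈ R, Γ'.comma ∉ w ∧ Γ'.bra ∉ w) (hX : ∀ p ∈ X, Γ'.comma ∉ p.1 ∧ Γ'.comma ∉ p.2)
    {L : ℕ} (hL : L = (delimit R ++ .bra :: delimit (X.flatMap fun p => [p.1, p.2])).length) :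
    Exec readInput (v, update (fun _ => []) .inp
        (delimit R ++ .bra :: delimit (X.flatMap fun p => [p.1, p.2])))
      ((v.1, none), workMem (fun t => delimit (tapeWords R X t)) R.length X.length)
      (22 * L + 10) := by
  have hbra : Γ'.bra ∉ delimit R := by
    simp only [delimit, List.mem_flatMap, not_exists, not_and]
    intro w hw
    simp [(hR w hw).2]
  have e : (update (fun _ => []) .inp
      (delimit R ++ .bra :: delimit (X.flatMap fun p => [p.1, p.2])) : Mem Tape Var) =
      readMem (delimit R ++ .bra :: delimit (X.flatMap fun p => [p.1, p.2])) (fun _ => []) 0 0 := by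
    funext s
    rcases s with _ | _ | t' | t' | x | x | x <;> try simp [readMem]
    cases x <;> rfl
  rw [e]
  refine (Exec.seq (exec_readRows _ _ hbra) (Exec.seq (exec_readPairs X hX) (Exec.seq
    (exec_move (by simp)) (Exec.seq (exec_move (by simp)) (exec_move (by simp)))))).congr ?_ ?_
  · congr 1
    rw [count_comma_delimit R fun w hw => (hR w hw).1]
    funext s
    rcases s with _ | _ | t | t | x | x | x
    case left => cases t <;> simp [readMem, workMem]
    case right => cases t <;> simp [readMem, workMem, tapeWords]
    all_goals simp [readMem, workMem]
  · have h1 := length_delimit_tapeWords_le R X .adj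
    have h2 := length_delimit_tapeWords_le R X .src
    have h3 := length_delimit_tapeWords_le R X .tgt
    simp [readMem, tapeWords] at h1 h2 h3 hL ⊢
    omega

/-- Pop all symbols of the given stacks. -/
def clearAll {T V : Type} (l : List (Stk T V)) : Prog T V :=
  l.foldr (fun k p => .seq (clear k) p) (.load fun v => (v.1, none))

theorem exec_clearAll {T V : Type} [DecidableEq T] [DecidableEq V] (l : List (Stk T V)) {v : Reg}
    {S : Mem T V} {L : ℕ} (hL : ∀ k, (S k).length ≤ L) :
    Exec (clearAll l) (v, S) ((v.1, none), fun k => if k ∈ l then [] else S k)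
      (l.length * (2 * L + 2) + 1) := by
  induction l generalizing v S with
  | nil => exact (Exec.load _ _ _).congr (by simp) (by simp)
  | cons k l ih =>
    have hL' : ∀ k', (update S k [] k').length ≤ L := by
      intro k'
      by_cases h : k' = k
      · subst h; simp
      · simpa [h] using hL k'
    refine (Exec.seq exec_clear (ih hL')).congr ?_ ?_
    · congr 1
      funext k'
      by_cases h : k' = k
      · subst h; simp
      · simp [h]
    · have := hL k
      simp only [List.length_cons, add_mul]
      omega

end Prog

open Prog

/-- The program that reads the input, decides the formula `φ` and clears all stacks. -/
noncomputable def CountFormula.decider (φ : CountFormula Tape Var) : Prog Tape Var :=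
  .seq readInput (.seq φ.toProg (clearAll Finset.univ.toList))

/-- A bound for the running time of `CountFormula.decider`. -/
noncomputable def CountFormula.deciderCost (φ : CountFormula Tape Var) : Polynomial ℕ :=
  (22 * .X + 10) + (φ.cost + (.C (Finset.univ.toList (α := Stk Tape Var)).length * (2 * .X + 2) + 1))

/-- The input length `L` bounds the contents of every tape and, as every word costs at least its
comma, also the bound of every counter. -/
theorem CountFormula.exec_decider (φ : CountFormula Tape Var) (R : List (List Γ'))
    (X : List (List Γ' × List Γ')) (hR : ∀ w ∈ R, Γ'.comma ∉ w ∧ Γ'.bra ∉ w)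
    (hX : ∀ p ∈ X, Γ'.comma ∉ p.1 ∧ Γ'.comma ∉ p.2)
    (hφ : φ.Proper (tapeWords R X) (Var.bound R.length X.length) fun _ => 0) {v : Reg} {L : ℕ}
    (hL : L = (delimit R ++ .bra :: delimit (X.flatMap fun p => [p.1, p.2])).length) :
    Exec φ.decider (v, update (fun _ => []) .inp
        (delimit R ++ .bra :: delimit (X.flatMap fun p => [p.1, p.2])))
      ((φ.eval (tapeWords R X) (Var.bound R.length X.length) fun _ => 0, none), fun _ => [])
      (φ.deciderCost.eval L) := by
  have hWL : ∀ t, (delimit (tapeWords R X t)).length ≤ L := fun t =>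
    hL ▸ length_delimit_tapeWords_le R X t
  have hb : ∀ x, Var.bound R.length X.length x ≤ L := by
    have h1 := (length_le_length_delimit _).trans (hWL .adj)
    have h2 := (length_le_length_delimit _).trans (hWL .src)
    simp only [tapeWords, List.length_map] at h1 h2
    intro x
    cases x <;> simp [Var.bound, h1, h2]
  have h := φ.exec_toProg (f := v.1) (o := none) (S := workMem (fun t => delimit (tapeWords R X t))
    R.length X.length) (W := tapeWords R X) (bnd := Var.bound R.length X.length) (e := fun _ => 0)
    (L := L) (by
      intro t w hw
      cases t
      · exact (hR w hw).1
      · simp only [tapeWords, List.mem_map] at hw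
        obtain ⟨p, hp, rfl⟩ := hw
        exact (hX p hp).1
      · simp only [tapeWords, List.mem_map] at hw
        obtain ⟨p, hp, rfl⟩ := hw
        exact (hX p hp).2)
    hWL hb (by simp [workMem]) (by simp [workMem]) rfl (by simp [workMem])
    (by simp [workMem]) hφ (by simp)
  refine (Exec.seq (exec_readInput R X hR hX hL) (Exec.seq h (exec_clearAll _ (L := L) ?_))).congr
    ?_ ?_
  · intro k
    rcases k with _ | _ | t | t | x | x | x <;> simp [workMem, hWL, hb]
  · simp
  · simp [deciderCost]

end DisjointPaths

/-! ### Disjoint paths in threshold graphs -/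

namespace DisjointPaths

section Graph

variable {V : Type*} {G : SimpleGraph V} {X : List (V × V)}

/-- In a threshold graph, the neighborhoods of any two vertices are comparable, up to the two
vertices themselves. -/
theorem IsThreshold.adj_imp_or_adj_imp (hG : IsThreshold G) (u v : V) :
    (∀ w, w ≠ v → G.Adj w u → G.Adj w v) ∨ (∀ w, w ≠ u → G.Adj w v → G.Adj w u) := by
  obtain ⟨C, I, hCI, hC, hI, l, -, hlI, hl⟩ := hG
  have hmem : ∀ w, w ∈ C ∨ w ∈ I := fun w => by
    have : w ∈ C ⊔ I := hCI.sup_eq_top ▸ Set.mem_univ w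
    exact this
  have hchain : ∀ a ∈ I, ∀ b ∈ I, G.neighborSet a ⊆ G.neighborSet b ∨
      G.neighborSet b ⊆ G.neighborSet a := by
    intro a ha b hb
    obtain ⟨i, hi, rfl⟩ := List.mem_iff_getElem.1 ((hlI a).2 ha)
    obtain ⟨j, hj, rfl⟩ := List.mem_iff_getElem.1 ((hlI b).2 hb)
    rcases lt_trichotomy i j with h | rfl | h
    · exact Or.inl (List.pairwise_iff_getElem.1 hl i j hi hj h)
    · exact Or.inl subset_rfl
    · exact Or.inr (List.pairwise_iff_getElem.1 hl j i hj hi h)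
  have hIC : ∀ {a w}, a ∈ I → G.Adj w a → w ∈ C := fun {a w} ha hw =>
    (hmem w).resolve_right fun h => hI h ha hw.ne hw
  rcases hmem u with hu | hu
  · rcases hmem v with hv | hv
    -- For `u` and `v` in the clique, witnesses `a`, `b` against the two inclusions lie in the
    -- independent set, and each sees just one of `u`, `v`; so their neighbourhoods would be
    -- incomparable.
    · by_contra! h
      obtain ⟨⟨a, hav, hau, hav'⟩, b, hbu, hbv, hbu'⟩ := h
      have ha : a ∈ I := (hmem a).resolve_left fun h => hav' (hC h hv hav)
      have hb : b ∈ I := (hmem b).resolve_left fun h => hbu' (hC h hu hbu)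
      rcases hchain a ha b hb with h | h
      · exact hbu' (h hau)
      · exact hav' (h hbv)
    · exact Or.inr fun w hwu hwv => hC (hIC hv hwv) hu hwu
  · rcases hmem v with hv | hv
    · exact Or.inl fun w hwv hwu => hC (hIC hu hwu) hv hwv
    · rcases hchain u hu v hv with h | h
      · exact Or.inl fun w _ hw => (h hw.symm).symm
      · exact Or.inr fun w _ hw => (h hw.symm).symm

/-- The vertex next to the end with the smaller neighbourhood is adjacent to both ends. It differs
from the other end because the path is not a single edge. -/
theorem IsThreshold.exists_common_neighbor (hG : IsThreshold G) {s t : V} (hst : s ≠ t)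
    {P : G.Walk s t} (hP : P.IsPath) (hlen : P.length ≠ 1) :
    ∃ w ∈ P.support, w ≠ s ∧ w ≠ t ∧ G.Adj w s ∧ G.Adj w t := by
  have key : ∀ {s t : V} (P : G.Walk s t), s ≠ t → P.IsPath → P.length ≠ 1 →
      (∀ w, w ≠ t → G.Adj w s → G.Adj w t) →
      ∃ w ∈ P.support, w ≠ s ∧ w ≠ t ∧ G.Adj w s ∧ G.Adj w t := by
    intro s t P hst hP hlen h
    cases P with
    | nil => exact absurd rfl hst
    | @cons _ w _ hsw P =>
      have hwt : w ≠ t := by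
        rintro rfl
        rw [SimpleGraph.Walk.cons_isPath_iff] at hP
        simp [SimpleGraph.Walk.length_eq_zero_iff.2 (SimpleGraph.Walk.isPath_iff_nil.1 hP.1)] at hlen
      exact ⟨w, by simp, hsw.ne', hwt, hsw.symm, h w hwt hsw.symm⟩
  rcases hG.adj_imp_or_adj_imp s t with h | h
  · exact key P hst hP hlen h
  · obtain ⟨w, hw, h1, h2, h3, h4⟩ := key P.reverse hst.symm hP.reverse (by simpa using hlen) h
    exact ⟨w, by simpa using hw, h2, h1, h4, h3⟩

theorem toSubgraph_eq_of_length_eq_one {s t s' t' : V} {P : G.Walk s t} {Q : G.Walk s' t'}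
    (hP : P.length = 1) (hQ : Q.length = 1) (h : s(s, t) = s(s', t')) :
    P.toSubgraph = Q.toSubgraph := by
  have key : ∀ {s t : V} (P : G.Walk s t), P.length = 1 →
      ∃ h : G.Adj s t, P.toSubgraph = G.subgraphOfAdj h := by
    intro s t P hP
    cases P with
    | nil => simp at hP
    | cons h P =>
      cases P with
      | nil => exact ⟨h, SimpleGraph.Walk.toSubgraph_cons_nil_eq_subgraphOfAdj _⟩
      | cons _ _ => simp at hP
  obtain ⟨h1, e1⟩ := key P hP
  obtain ⟨h2, e2⟩ := key Q hQ
  rw [e1, e2]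
  rcases Sym2.eq_iff.1 h with ⟨rfl, rfl⟩ | ⟨rfl, rfl⟩
  · rfl
  · exact SimpleGraph.subgraphOfAdj_symm _

/-- The vertex belongs to some terminal pair. -/
def IsTerminal (X : List (V × V)) (w : V) : Prop :=
  ∃ i : Fin X.length, (X.get i).1 = w ∨ (X.get i).2 = w

/-- The unordered `i`-th terminal pair. -/
def pairAt (X : List (V × V)) (i : Fin X.length) : Sym2 V := s((X.get i).1, (X.get i).2)

/-- The `i`-th pair cannot be given the edge between its two vertices, if the first occurrence of
each pair is preferred. -/
def NeedsInner (G : SimpleGraph V) (X : List (V × V)) (i : Fin X.length) : Prop :=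
  ¬G.Adj (X.get i).1 (X.get i).2 ∨ ∃ j < i, pairAt X j = pairAt X i

/-- The vertex can be the only inner vertex of a path for the `i`-th pair. -/
def CanServe (G : SimpleGraph V) (X : List (V × V)) (i : Fin X.length) (w : V) : Prop :=
  G.Adj w (X.get i).1 ∧ G.Adj w (X.get i).2 ∧ ¬IsTerminal X w

theorem CanServe.of_pairAt_eq {i j : Fin X.length} {w : V} (h : CanServe G X i w)
    (hij : pairAt X i = pairAt X j) : CanServe G X j w := by
  obtain ⟨h1, h2, h3⟩ := h
  rcases Sym2.eq_iff.1 hij with ⟨e1, e2⟩ | ⟨e1, e2⟩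
  · exact ⟨e1 ▸ h1, e2 ▸ h2, h3⟩
  · exact ⟨e2 ▸ h2, e1 ▸ h1, h3⟩

/-- A pair takes an inner vertex of its own path if that is not an edge. Otherwise it swaps roles
with the first occurrence of the same pair, whose path cannot be the edge too; `host` records whose
path is used. An inner vertex is no terminal, since it is an end of neither its own path nor any
other. -/
theorem IsThreshold.exists_injOn_of_hasDisjointPaths (hG : IsThreshold G)
    (hX : ∀ p ∈ X, p.1 ≠ p.2) (h : HasDisjointPaths G X) :
    ∃ f : Fin X.length → V, (∀ i, NeedsInner G X i → CanServe G X i (f i)) ∧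
      Set.InjOn f {i | NeedsInner G X i} := by
  classical
  obtain ⟨P, hP, hPP⟩ := h
  have hne : ∀ i : Fin X.length, (X.get i).1 ≠ (X.get i).2 := fun i => hX _ (List.get_mem _ _)
  have hinner : ∀ i, ∃ w, (P i).length ≠ 1 → w ∈ (P i).support ∧ w ≠ (X.get i).1 ∧
      w ≠ (X.get i).2 ∧ G.Adj w (X.get i).1 ∧ G.Adj w (X.get i).2 := fun i => by
    by_cases hi : (P i).length = 1
    · exact ⟨(X.get i).1, fun h => absurd hi h⟩
    · obtain ⟨w, hw⟩ := hG.exists_common_neighbor (hne i) (hP i) hi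
      exact ⟨w, fun _ => hw⟩
  choose g hg using hinner
  have hhost : ∀ i, ∃ k, NeedsInner G X i → (P k).length ≠ 1 ∧ pairAt X k = pairAt X i ∧
      (k = i ∨ (P i).length = 1 ∧ ¬NeedsInner G X k) := by
    intro i
    by_cases hi : (P i).length = 1
    · have hadj := SimpleGraph.Walk.adj_of_length_eq_one hi
      by_cases hn : NeedsInner G X i
      · obtain ⟨j, hji, hj⟩ := hn.resolve_left (not_not_intro hadj)
        obtain ⟨k, hk, hmin⟩ := WellFounded.has_min (wellFounded_lt (α := Fin X.length))
          {k | pairAt X k = pairAt X i} ⟨j, hj⟩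
        have hki : k ≠ i := by
          rintro rfl
          exact hmin j hj hji
        refine ⟨k, fun _ => ⟨fun hlen => (hPP k i hki).1
          (toSubgraph_eq_of_length_eq_one hlen hi hk), hk, Or.inr ⟨hi, ?_⟩⟩⟩
        rintro (h | ⟨k', hk', h⟩)
        · rcases Sym2.eq_iff.1 hk with ⟨e1, e2⟩ | ⟨e1, e2⟩
          · exact h (by rw [e1, e2]; exact hadj)
          · exact h (by rw [e1, e2]; exact hadj.symm)
        · exact hmin k' (h.trans hk) hk'
      · exact ⟨i, fun h => absurd h hn⟩
    · exact ⟨i, fun _ => ⟨hi, rfl, Or.inl rfl⟩⟩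
  choose host hh using hhost
  refine ⟨fun i => g (host i), fun i hi => ?_, fun i hi i' hi' hii' => ?_⟩
  · obtain ⟨hlen, hpair, -⟩ := hh i hi
    obtain ⟨h1, h2, h3, h4, h5⟩ := hg _ hlen
    refine CanServe.of_pairAt_eq ⟨h4, h5, ?_⟩ hpair
    rintro ⟨j, hj⟩
    beta_reduce at hj
    by_cases hji : host i = j
    · subst hji
      rcases hj with hj | hj
      · exact h2 hj.symm
      · exact h3 hj.symm
    · have := (hPP _ _ hji).2.1 _ h1 h2 h3
      rcases hj with hj | hj
      · exact this (by rw [← hj]; exact (P j).start_mem_support)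
      · exact this (by rw [← hj]; exact (P j).end_mem_support)
  · obtain ⟨hlen, hpair, hcase⟩ := hh i hi
    obtain ⟨hlen', hpair', hcase'⟩ := hh i' hi'
    -- Different hosts have disjoint interiors. A shared host leaves either one pair using its own
    -- path, a host both in need and not in need, or two occurrences on the same edge.
    have e : host i = host i' := by
      by_contra hne
      obtain ⟨h1, h2, h3, -⟩ := hg _ hlen
      refine (hPP _ _ hne).2.1 _ h1 h2 h3 ?_
      rw [show g (host i) = g (host i') from hii']
      exact (hg _ hlen').1
    by_contra hne
    rcases hcase with hc | ⟨hc1, hc2⟩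
    · rcases hcase' with hc' | ⟨hc1', hc2'⟩
      · exact hne (by rw [← hc, ← hc', e])
      · rw [← e, hc] at hc2'
        exact hc2' hi
    · rcases hcase' with hc' | ⟨hc1', hc2'⟩
      · rw [e, hc'] at hc2
        exact hc2 hi'
      · exact (hPP i i' hne).1 (toSubgraph_eq_of_length_eq_one hc1 hc1'
          (hpair.symm.trans (e ▸ hpair')))

/-- Take the edge, or the path of length 2 through `f i`. As `f i` is not a terminal and `f` is
injective where it matters, `f i` lies on no other path. Two equal paths would be edges for the same
pair, but then the later occurrence needs an inner vertex. -/
theorem hasDisjointPaths_of_injOn (hX : ∀ p ∈ X, p.1 ≠ p.2) {f : Fin X.length → V}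
    (hf : ∀ i, NeedsInner G X i → CanServe G X i (f i))
    (hinj : Set.InjOn f {i | NeedsInner G X i}) : HasDisjointPaths G X := by
  have hne : ∀ i : Fin X.length, (X.get i).1 ≠ (X.get i).2 := fun i => hX _ (List.get_mem _ _)
  have hpath : ∀ i, ∃ P : G.Walk (X.get i).1 (X.get i).2, P.IsPath ∧
      ∀ v, v ∈ P.support ↔ v = (X.get i).1 ∨ v = (X.get i).2 ∨ NeedsInner G X i ∧ v = f i := by
    intro i
    by_cases hi : NeedsInner G X i
    · obtain ⟨h1, h2, -⟩ := hf i hi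
      refine ⟨.cons h1.symm (.cons h2 .nil), ?_, fun v => ?_⟩
      · simpa [SimpleGraph.Walk.cons_isPath_iff] using ⟨h2.ne, h1.ne', hne i⟩
      · simp [hi]
        tauto
    · have hadj : G.Adj (X.get i).1 (X.get i).2 := by
        by_contra h
        exact hi (Or.inl h)
      refine ⟨.cons hadj .nil, ?_, fun v => ?_⟩
      · simp [SimpleGraph.Walk.cons_isPath_iff]
        exact hne i
      · simp [hi]
  choose P hP hsupp using hpath
  have hterm : ∀ {i}, NeedsInner G X i → ∀ j, f i ∈ (P j).support → j = i := by
    intro i hi j hj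
    have hnt := (hf i hi).2.2
    rcases (hsupp j _).1 hj with h | h | ⟨hj, h⟩
    · exact absurd ⟨j, Or.inl h.symm⟩ hnt
    · exact absurd ⟨j, Or.inr h.symm⟩ hnt
    · exact hinj hj hi h.symm
  have hdisj : ∀ i j, i ≠ j → ∀ v ∈ (P i).support, v ≠ (X.get i).1 → v ≠ (X.get i).2 →
      v ∉ (P j).support := by
    intro i j hij v hv h1 h2 hv'
    obtain ⟨hi, rfl⟩ := (((hsupp i v).1 hv).resolve_left h1).resolve_left h2
    exact hij (hterm hi j hv').symm
  refine ⟨P, hP, fun i j hij => ⟨fun he => ?_, hdisj i j hij, hdisj j i hij.symm⟩⟩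
  have hs : ∀ v, v ∈ (P i).support ↔ v ∈ (P j).support := fun v => by
    rw [← SimpleGraph.Walk.mem_verts_toSubgraph, he, SimpleGraph.Walk.mem_verts_toSubgraph]
  have hi : ¬NeedsInner G X i := fun hi =>
    hij (hterm hi j ((hs _).1 ((hsupp i _).2 (Or.inr (Or.inr ⟨hi, rfl⟩))))).symm
  have hj : ¬NeedsInner G X j := fun hj =>
    hij (hterm hj i ((hs _).2 ((hsupp j _).2 (Or.inr (Or.inr ⟨hj, rfl⟩)))))
  have hpair : pairAt X i = pairAt X j := by
    have h1 := (hsupp j _).1 ((hs _).1 (P i).start_mem_support)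
    have h2 := (hsupp j _).1 ((hs _).1 (P i).end_mem_support)
    have := hne i
    simp only [hj, false_and, or_false] at h1 h2
    rw [pairAt, pairAt, Sym2.eq_iff]
    grind
  rcases lt_or_gt_of_ne hij with h | h
  · exact hj (Or.inr ⟨i, h, hpair⟩)
  · exact hi (Or.inr ⟨j, h, hpair.symm⟩)

/-- The candidates of a pair are the non-terminal neighbours of whichever end has the smaller
neighbourhood. The exceptional vertices in the comparison of neighbourhoods are terminals, so they
do not interfere. -/
theorem IsThreshold.canServe_imp_or_imp (hG : IsThreshold G) (i j : Fin X.length) :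
    (∀ w, CanServe G X i w → CanServe G X j w) ∨ (∀ w, CanServe G X j w → CanServe G X i w) := by
  have key : ∀ i : Fin X.length, ∃ m, IsTerminal X m ∧
      ∀ w, CanServe G X i w ↔ G.Adj w m ∧ ¬IsTerminal X w := by
    intro i
    have h1 : IsTerminal X (X.get i).1 := ⟨i, Or.inl rfl⟩
    have h2 : IsTerminal X (X.get i).2 := ⟨i, Or.inr rfl⟩
    rcases hG.adj_imp_or_adj_imp (X.get i).1 (X.get i).2 with h | h
    · exact ⟨_, h1, fun w => ⟨fun hw => ⟨hw.1, hw.2.2⟩,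
        fun hw => ⟨hw.1, h w (by rintro rfl; exact hw.2 h2) hw.1, hw.2⟩⟩⟩
    · exact ⟨_, h2, fun w => ⟨fun hw => hw.2,
        fun hw => ⟨h w (by rintro rfl; exact hw.2 h1) hw.1, hw⟩⟩⟩
  obtain ⟨a, ha, hai⟩ := key i
  obtain ⟨b, hb, hbj⟩ := key j
  simp only [hai, hbj]
  rcases hG.adj_imp_or_adj_imp a b with h | h
  · exact Or.inl fun w hw => ⟨h w (by rintro rfl; exact hw.2 hb) hw.1, hw.2⟩
  · exact Or.inr fun w hw => ⟨h w (by rintro rfl; exact hw.2 ha) hw.1, hw.2⟩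

open Classical in
/-- A threshold graph has the required paths if and only if, for each `c`, at most `c` of the pairs
that need an inner vertex have at most `c` candidates for it. -/
theorem IsThreshold.hasDisjointPaths_iff [Fintype V] (hG : IsThreshold G)
    (hX : ∀ p ∈ X, p.1 ≠ p.2) :
    HasDisjointPaths G X ↔ ∀ c < Fintype.card V,
      (Finset.univ.filter fun i => NeedsInner G X i ∧
        (Finset.univ.filter fun w => CanServe G X i w).card ≤ c).card ≤ c := by
  constructor
  · intro h c _
    obtain ⟨f, hf, hinj⟩ := hG.exists_injOn_of_hasDisjointPaths hX h
    rcases Finset.eq_empty_or_nonempty (Finset.univ.filter fun i => NeedsInner G X i ∧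
        (Finset.univ.filter fun w => CanServe G X i w).card ≤ c) with he | he
    · simp [he]
    obtain ⟨e, he, hmax⟩ := Finset.exists_max_image _
      (fun i => (Finset.univ.filter fun w => CanServe G X i w).card) he
    -- By the chain property, the largest candidate set, that of `e`, contains all the others, so
    -- `f` maps all these pairs into a set of size at most `c`.
    simp only [Finset.mem_filter, Finset.mem_univ, true_and] at he hmax
    refine (Finset.card_le_card_of_injOn f (t := Finset.univ.filter fun w => CanServe G X e w)
      ?_ ?_).trans he.2
    · intro i hi
      simp only [Finset.coe_filter, Finset.mem_univ, true_and, Set.mem_ofPred_eq] at hi ⊢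
      rcases hG.canServe_imp_or_imp (X := X) i e with h | h
      · exact h _ (hf i hi.1)
      · have := Finset.eq_of_subset_of_card_le
          (Finset.monotone_filter_right Finset.univ fun w _ => h w) (hmax i hi)
        have hfi : f i ∈ Finset.univ.filter fun w => CanServe G X i w := by simpa using hf i hi.1
        rw [← this] at hfi
        simpa using hfi
    · exact hinj.mono fun i hi => by simpa using (Finset.mem_filter.1 hi).2.1
  · intro h
    -- Hall's theorem: with `c` the largest number of candidates in `s`, reached at `e`, the
    -- hypothesis gives `s.card ≤ c`, and the candidates of `e` alone fill the union. An end of `e`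
    -- is not its own neighbour, so `c` is below the number of vertices.
    have hall := (Finset.all_card_le_biUnion_card_iff_exists_injective
      (fun i : {i // NeedsInner G X i} => Finset.univ.filter fun w => CanServe G X i w)).1 (by
        intro s
        rcases s.eq_empty_or_nonempty with rfl | hs
        · simp
        obtain ⟨e, he, hmax⟩ := Finset.exists_max_image s
          (fun i => (Finset.univ.filter fun w => CanServe G X i w).card) hs
        have hlt : (Finset.univ.filter fun w => CanServe G X e w).card < Fintype.card V := by
          refine Finset.card_lt_univ_of_notMem (x := (X.get e).1) ?_
          simp only [Finset.mem_filter, Finset.mem_univ, true_and]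
          exact fun hw => hw.1.ne rfl
        calc s.card = (s.map (Function.Embedding.subtype _)).card := (Finset.card_map _).symm
          _ ≤ _ := Finset.card_le_card (fun i hi => by
            simp only [Finset.mem_map, Function.Embedding.subtype_apply] at hi
            obtain ⟨i, hi, rfl⟩ := hi
            simp only [Finset.mem_filter, Finset.mem_univ, true_and]
            exact ⟨i.2, hmax i hi⟩)
          _ ≤ _ := h _ hlt
          _ ≤ _ := Finset.card_le_card (Finset.subset_biUnion_of_mem
            (fun i : {i // NeedsInner G X i} => Finset.univ.filter fun w => CanServe G X i w) he))
    obtain ⟨f, hinj, hf⟩ := hall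
    refine hasDisjointPaths_of_injOn hX
      (f := fun i => if h : NeedsInner G X i then f ⟨i, h⟩ else (X.get i).1) ?_ ?_
    · intro i hi
      have := hf ⟨i, hi⟩
      simpa [hi] using this
    · intro i hi j hj hij
      simp only [Set.mem_ofPred_eq] at hi hj
      simp only [hi, hj, dite_true] at hij
      simpa using hinj hij

end Graph

end DisjointPaths

/-! ### The criterion as a formula -/

namespace DisjointPaths

open Function

namespace CountFormula

/-- Disjunction. -/
def or {T V : Type} (φ ψ : CountFormula T V) : CountFormula T V := .not (.and (.not φ) (.not ψ))

/-- Existential quantification. -/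
def ex {T : Type} (x : Var) (φ : CountFormula T Var) : CountFormula T Var :=
  .not (.countLe x φ .zero)

/-- The vertices `a` and `b` are adjacent. -/
def adj (a b : Var) : CountFormula Tape Var := .symbol .adj a b (.bit true)

/-- The vertex `b` is the first one of the pair `a`. -/
def source (a b : Var) : CountFormula Tape Var := .symbol .src a b .comma

/-- The vertex `b` is the second one of the pair `a`. -/
def target (a b : Var) : CountFormula Tape Var := .symbol .tgt a b .comma

/-- The vertex `w` is a terminal. -/
def terminal : CountFormula Tape Var := .ex .j (.or (.source .j .w) (.target .j .w))

/-- The vertex `w` can be the only inner vertex of a path for the pair `i`. -/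
def canServe : CountFormula Tape Var :=
  .and (.ex .u (.and (.source .i .u) (.adj .w .u)))
    (.and (.ex .u (.and (.target .i .u) (.adj .w .u))) (.not terminal))

/-- The vertices of the pair `i` are adjacent. -/
def adjacentPair : CountFormula Tape Var :=
  .ex .u (.and (.source .i .u) (.ex .v (.and (.target .i .v) (.adj .u .v))))

/-- The unordered pairs `i` and `j` are equal. -/
def samePair : CountFormula Tape Var :=
  .ex .u (.and (.source .i .u) (.ex .v (.and (.target .i .v)
    (.or (.and (.source .j .u) (.target .j .v)) (.and (.source .j .v) (.target .j .u))))))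

/-- The pair `i` needs an inner vertex. -/
def needsInner : CountFormula Tape Var :=
  .or (.not adjacentPair) (.ex .j (.and (.not (.le .i .j)) samePair))

/-- For each `c`, at most `c` of the pairs that need an inner vertex have at most `c` candidates for
it. -/
def disjointPaths : CountFormula Tape Var :=
  .not (.ex .c (.not (.countLe .i (.and needsInner (.countLe .w canServe .c)) .c)))

end CountFormula

open CountFormula

theorem count_eq_card {n : ℕ} (p : ℕ → Prop) [DecidablePred p] (P : Fin n → Prop) [DecidablePred P]
    (h : ∀ i : Fin n, p i ↔ P i) : Nat.count p n = (Finset.univ.filter P).card := by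
  rw [Nat.count_eq_card_filter_range, ← Finset.card_map Fin.valEmbedding]
  congr 1
  ext m
  simp only [Finset.mem_filter, Finset.mem_range, Finset.mem_map, Finset.mem_univ, true_and,
    Fin.valEmbedding_apply]
  constructor
  · rintro ⟨hm, hp⟩
    exact ⟨⟨m, hm⟩, (h _).1 hp, rfl⟩
  · rintro ⟨i, hi, rfl⟩
    exact ⟨i.2, (h i).2 hi⟩

/-- The comma after a unary word stands at the position equal to its value; this is why `source` and
`target` look for a comma. -/
theorem getElem?_unary_append (a m : ℕ) : (unary a ++ [Γ'.comma])[m]? = some .comma ↔ m = a := by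
  rw [unary]
  rcases lt_trichotomy m a with h | rfl | h
  · simp [List.getElem?_append_left, h, h.ne]
  · simp
  · simp [h, h.ne']

namespace VDPInstance

variable (x : VDPInstance)

/-- The rows of the adjacency matrix. -/
noncomputable def rows : List (List Γ') := List.ofFn (adjRow x.graph)

/-- The terminal pairs in unary. -/
def pairWords : List (List Γ' × List Γ') := x.pairs.map fun p => (unary p.1, unary p.2)

/-- The formula holds in the instance, for the values `e` of the free variables. -/
def Holds (φ : CountFormula Tape Var) (e : Var → ℕ) : Prop :=
  φ.eval (tapeWords x.rows x.pairWords) (Var.bound x.n x.pairs.length) e = true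

variable {x} {e : Var → ℕ} {φ ψ : CountFormula Tape Var}

theorem holds_not : x.Holds (.not φ) e ↔ ¬x.Holds φ e := by simp [Holds, CountFormula.eval]

theorem holds_and : x.Holds (.and φ ψ) e ↔ x.Holds φ e ∧ x.Holds ψ e := by simp [Holds, CountFormula.eval]

theorem holds_or : x.Holds (.or φ ψ) e ↔ x.Holds φ e ∨ x.Holds ψ e := by
  simp [CountFormula.or, holds_not, holds_and]; tauto

theorem holds_le {a b : Var} : x.Holds (.le a b) e ↔ e a ≤ e b := by simp [Holds, CountFormula.eval]

theorem holds_countLe {a b : Var} {n : ℕ} (hn : Var.bound x.n x.pairs.length a = n)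
    (P : Fin n → Prop) [DecidablePred P] (h : ∀ m : Fin n, x.Holds φ (update e a m) ↔ P m) :
    x.Holds (.countLe a φ b) e ↔ (Finset.univ.filter P).card ≤ e b := by
  subst hn
  rw [← count_eq_card (fun m => φ.eval (tapeWords x.rows x.pairWords)
    (Var.bound x.n x.pairs.length) (update e a m) = true) P h]
  simp [Holds, CountFormula.eval]

theorem holds_ex {a : Var} {n : ℕ} (hn : Var.bound x.n x.pairs.length a = n) (h0 : e .zero = 0) :
    x.Holds (.ex a φ) e ↔ ∃ m : Fin n, x.Holds φ (update e a m) := by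
  classical
  rw [CountFormula.ex, holds_not, holds_countLe hn _ fun _ => Iff.rfl, h0]
  simp [Finset.filter_eq_empty_iff]

theorem holds_adj {a b : Var} {u v : Fin x.n} (hu : e a = u) (hv : e b = v) :
    x.Holds (.adj a b) e ↔ x.graph.Adj u v := by
  have h1 : (tapeWords x.rows x.pairWords .adj)[e a]? = some (adjRow x.graph u) := by
    simp [tapeWords, rows, hu]
  have h2 : (adjRow x.graph u ++ [Γ'.comma])[e b]? =
      some (Γ'.bit (@decide _ (Classical.propDecidable (x.graph.Adj u v)))) := by
    rw [List.getElem?_append_left (by simp [adjRow, hv])]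
    simp [adjRow, hv]
  rw [Holds, CountFormula.adj, CountFormula.eval, h1, Option.getD_some, h2]
  simp

theorem holds_source {a b : Var} {i : Fin x.pairs.length} (hi : e a = i) :
    x.Holds (.source a b) e ↔ e b = (x.pairs.get i).1 := by
  simp [Holds, CountFormula.eval, CountFormula.source, tapeWords, pairWords, hi, getElem?_unary_append]

theorem holds_target {a b : Var} {i : Fin x.pairs.length} (hi : e a = i) :
    x.Holds (.target a b) e ↔ e b = (x.pairs.get i).2 := by
  simp [Holds, CountFormula.eval, CountFormula.target, tapeWords, pairWords, hi, getElem?_unary_append]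

theorem holds_terminal {w : Fin x.n} (h0 : e .zero = 0) (hw : e .w = w) :
    x.Holds terminal e ↔ IsTerminal x.pairs w := by
  rw [terminal, holds_ex rfl h0]
  refine exists_congr fun j => ?_
  rw [holds_or, holds_source (i := j) (by simp), holds_target (i := j) (by simp)]
  simp [hw, Fin.val_inj, eq_comm]

/-- The atom pins down the value of `b`, so the quantifier acts as an assignment. -/
theorem holds_ex_source_and {a b : Var} {i : Fin x.pairs.length}
    (hb : Var.bound x.n x.pairs.length b = x.n) (hab : a ≠ b) (h0 : e .zero = 0) (hi : e a = i) :
    x.Holds (.ex b (.and (.source a b) φ)) e ↔ x.Holds φ (update e b (x.pairs.get i).1) := by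
  rw [holds_ex hb h0]
  have h : ∀ m : Fin x.n, x.Holds (.and (.source a b) φ) (update e b m) ↔
      m = (x.pairs.get i).1 ∧ x.Holds φ (update e b m) := fun m => by
    rw [holds_and, holds_source (i := i) (by simp [hab, hi])]
    simp [Fin.val_inj]
  simp [h]

theorem holds_ex_target_and {a b : Var} {i : Fin x.pairs.length}
    (hb : Var.bound x.n x.pairs.length b = x.n) (hab : a ≠ b) (h0 : e .zero = 0) (hi : e a = i) :
    x.Holds (.ex b (.and (.target a b) φ)) e ↔ x.Holds φ (update e b (x.pairs.get i).2) := by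
  rw [holds_ex hb h0]
  have h : ∀ m : Fin x.n, x.Holds (.and (.target a b) φ) (update e b m) ↔
      m = (x.pairs.get i).2 ∧ x.Holds φ (update e b m) := fun m => by
    rw [holds_and, holds_target (i := i) (by simp [hab, hi])]
    simp [Fin.val_inj]
  simp [h]

theorem holds_canServe {i : Fin x.pairs.length} {w : Fin x.n} (h0 : e .zero = 0) (hi : e .i = i)
    (hw : e .w = w) : x.Holds canServe e ↔ CanServe x.graph x.pairs i w := by
  rw [canServe, holds_and, holds_and, holds_not, holds_terminal h0 hw,
    holds_ex_source_and rfl (by simp) h0 hi, holds_ex_target_and rfl (by simp) h0 hi,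
    holds_adj (u := w) (v := (x.pairs.get i).1) (by simp [hw]) (by simp),
    holds_adj (u := w) (v := (x.pairs.get i).2) (by simp [hw]) (by simp)]
  rfl

theorem holds_adjacentPair {i : Fin x.pairs.length} (h0 : e .zero = 0) (hi : e .i = i) :
    x.Holds adjacentPair e ↔ x.graph.Adj (x.pairs.get i).1 (x.pairs.get i).2 := by
  rw [adjacentPair, holds_ex_source_and rfl (by simp) h0 hi,
    holds_ex_target_and (i := i) rfl (by simp) (by simp [h0]) (by simp [hi]),
    holds_adj (u := (x.pairs.get i).1) (v := (x.pairs.get i).2) (by simp) (by simp)]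

theorem holds_samePair {i j : Fin x.pairs.length} (h0 : e .zero = 0) (hi : e .i = i)
    (hj : e .j = j) : x.Holds samePair e ↔ pairAt x.pairs j = pairAt x.pairs i := by
  rw [samePair, holds_ex_source_and rfl (by simp) h0 hi,
    holds_ex_target_and (i := i) rfl (by simp) (by simp [h0]) (by simp [hi]), holds_or, holds_and,
    holds_and, holds_source (i := j) (by simp [hj]), holds_source (i := j) (by simp [hj]),
    holds_target (i := j) (by simp [hj]), holds_target (i := j) (by simp [hj]), pairAt, pairAt,
    Sym2.eq_iff]
  simp only [ne_eq, reduceCtorEq, not_false_eq_true, update_self, update_of_ne, Fin.val_inj]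
  simp only [eq_comm, and_comm]

theorem holds_needsInner {i : Fin x.pairs.length} (h0 : e .zero = 0) (hi : e .i = i) :
    x.Holds needsInner e ↔ NeedsInner x.graph x.pairs i := by
  rw [needsInner, holds_or, holds_not, holds_adjacentPair h0 hi, holds_ex rfl h0, NeedsInner]
  refine or_congr Iff.rfl (exists_congr fun j => ?_)
  rw [holds_and, holds_not, holds_le, holds_samePair (i := i) (j := j) (by simp [h0]) (by simp [hi])
    (by simp)]
  simp [hi]
  exact fun _ => Iff.rfl

open Classical in
theorem holds_disjointPaths (hx : IsThreshold x.graph) :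
    x.Holds disjointPaths (fun _ => 0) ↔ HasDisjointPaths x.graph x.pairs := by
  rw [hx.hasDisjointPaths_iff x.pairs_ne, disjointPaths, holds_not, holds_ex rfl rfl]
  simp only [holds_not, not_exists, not_not, Fintype.card_fin]
  rw [← Fin.forall_iff (p := fun c : Fin x.n => (Finset.univ.filter fun i =>
    NeedsInner x.graph x.pairs i ∧ (Finset.univ.filter fun w => CanServe x.graph x.pairs i w).card ≤
      (c : ℕ)).card ≤ (c : ℕ))]
  refine forall_congr' fun c => ?_
  refine (holds_countLe (n := x.pairs.length) rfl (fun i => NeedsInner x.graph x.pairs i ∧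
    (Finset.univ.filter fun w => CanServe x.graph x.pairs i w).card ≤ (c : ℕ)) fun i => ?_).trans ?_
  · rw [holds_and, holds_needsInner (i := i) (by simp) (by simp),
      holds_countLe (n := x.n) rfl (fun w => CanServe x.graph x.pairs i w)
        fun w => holds_canServe (by simp) (by simp) (by simp)]
    simp
  · simp

theorem proper_disjointPaths (x : VDPInstance) :
    disjointPaths.Proper (tapeWords x.rows x.pairWords) (Var.bound x.n x.pairs.length)
      fun _ => 0 := by
  simp +contextual [disjointPaths, CountFormula.ex, CountFormula.or, needsInner, canServe, terminal,
    adjacentPair, samePair, CountFormula.source, CountFormula.target, CountFormula.adj, Proper,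
    Binds, tapeWords, rows, pairWords, Var.bound]

end VDPInstance

/-- On threshold graphs, the program that decides the formula `disjointPaths` solves Vertex-Disjoint
Paths. -/
theorem solvableInPolyTimeOn_isThreshold :
    SolvableInPolyTimeOn VDPInstance.encode (fun x => IsThreshold x.graph)
      (fun x => HasDisjointPaths x.graph x.pairs) := by
  refine StackProg.nonempty_computableInPolyTime CountFormula.disjointPaths.decider .inp
    (false, none) Prod.fst CountFormula.disjointPaths.deciderCost ?_
  rintro ⟨x, hx⟩
  have henc : x.encode = delimit x.rows ++
      Γ'.bra :: delimit (x.pairWords.flatMap fun p => [p.1, p.2]) := by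
    simp [VDPInstance.encode, VDPInstance.rows, VDPInstance.pairWords, List.flatMap_map]
  have hR : x.rows.length = x.n := by simp [VDPInstance.rows]
  have hX : x.pairWords.length = x.pairs.length := by simp [VDPInstance.pairWords]
  have h := CountFormula.disjointPaths.exec_decider x.rows x.pairWords (by
      intro w hw
      obtain ⟨u, rfl⟩ := (List.mem_ofFn' _ _).1 hw
      simp [adjRow, List.mem_ofFn]) (by
      intro p hp
      obtain ⟨q, -, rfl⟩ := List.mem_map.1 hp
      simp [unary, List.mem_replicate])
    (by rw [hR, hX]; exact x.proper_disjointPaths) (v := (false, none)) rfl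
  rw [← henc, hR, hX] at h
  refine ⟨_, ?_, h⟩
  have := VDPInstance.holds_disjointPaths hx
  rw [VDPInstance.Holds] at this
  simp only [← this]
  simp

end DisjointPaths

theorem theorem9 :
    DisjointPaths.SolvableInPolyTimeOn DisjointPaths.VDPInstance.encode
      (fun x => DisjointPaths.IsThreshold x.graph)
      (fun x => DisjointPaths.HasDisjointPaths x.graph x.pairs) :=
  DisjointPaths.solvableInPolyTimeOn_isThreshold
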